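/- **Theorem 1.3.** Let $1\le\alpha\le 2$ with $\alpha<n$, let $\lambda>0$, $K\ge 0$, let $\Omega\subseteq\mathbb{R}^n$ be open and bounded, and consider $$Lu=-\sum_{i,j=1}^n \frac{\partial}{\partial x_i}\Big(a_{ij}\frac{\partial u}{\partial x_j}\Big)+\sum_{i=1}^n b_i\frac{\partial u}{\partial x_i}+Vu,$$ where $a_{ij}\in L^\infty(\Omega)$, the matrix $(a_{ij}(x))$ is symmetric and $\lambda|\xi|^2\le\sum_{i,j}a_{ij}(x)\xi_i\xi_j\le\lambda^{-1}|\xi|^2$ for all $\xi\in\mathbb{R}^n$ and almost every $x\in\Omega$, and $b_i,V:\mathbb{R}^n\to\mathbb{R}$ are measurable. Assume that one of the following two conditions holds. (M) $1<\alpha\le 2$, $1<p<n/\alpha$, $b_i^2\in L^{p,\varphi}$ for $i=1,\dots,n$, $V\in L^{p,\varphi}\cap L^2_{\rm loc}(\mathbb{R}^n)$, and the norms $\|b_i^2\|_{L^{p,\varphi}}$ and $\|V\|_{L^{p,\varphi}}$ are at most $K$. Here $L^{p,\varphi}$ is the space of all $f\in L^p_{\rm loc}(\mathbb{R}^n)$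 with $$\|f\|_{L^{p,\varphi}}=\sup_{x\in\mathbb{R}^n,\,r>0}\Big(\frac1{\varphi(r)}\int_{|x-y|<r}|f(y)|^p\,dy\Big)^{1/p}<\infty,$$ and $\varphi:(0,\infty)\to(0,\infty)$ satisfies, for some constants $C_1,C_2,C_3>0$: $\varphi(s)\le C_1\varphi(t)$ and $\varphi(s)s^{-n}\ge C_2\,\varphi(t)t^{-n}$ whenever $0<s\le t$, and $$\int_\delta^\infty \frac{\varphi(t)}{t^{(n+1)-\frac p2(\alpha+1)}}\,dt\le C_3\,\delta^{\frac p2(1-\alpha)}\quad\text{for all }\delta>0.$$ (S) $1\le\alpha\le2$, $b_i^2\in\tilde S_\alpha$ for $i=1,\dots,n$, $V\in\tilde S_\alpha$, and $\eta_\alpha(b_i^2)(2)\le K$, $\eta_\alpha V(2)\le K$. Here $\tilde S_\alpha$ is the class of all $f\in L^1_{\rm loc}(\mathbb{R}^n)$ with $$\eta_\alpha f(r)=\sup_{x\in\mathbb{R}^n}\int_{|x-y|<r}\frac{|f(y)|}{|x-y|^{n-\alpha}}\,dy<\infty\quad\text{for all }r>0.$$ Then there is a constant $C>0$, depending only on $n,\alpha,\lambda,K$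 and, in case (M), on $p$ and $\varphi$, such that the following holds. Let $u\in H^1_0(\Omega)$ (the closure of $C_0^\infty(\Omega)$ in $H^1(\Omega)$) satisfy $u\ge0$ a.e. in $\Omega$ and be a weak solution of $Lu=0$, that is, $$\int_\Omega\Big(\sum_{i,j}a_{ij}\frac{\partial u}{\partial x_i}\frac{\partial\psi}{\partial x_j}+\sum_i b_i\frac{\partial u}{\partial x_i}\psi+Vu\psi\Big)dx=0\quad\text{for all }\psi\in H^1_0(\Omega).$$ Then for every ball with $B(x,2r)\subseteq\Omega$, $0<r\le1$, and every $\delta>0$, the function $f=\log(u+\delta)$ is integrable on $B(x,r)$ and, writing $f_B=\frac1{|B|}\int_B f$, $$\frac1{|B(x,r)|}\int_{B(x,r)}\big|f-f_{B(x,r)}\big|^\alpha\,dy\le C .$$ Moreover $\log(u+\delta)\in BMO_\alpha(B(x,r))$: the quantities $\big(\frac1{|B'|}\int_{B'}|f-f_{B'}|^\alpha\,dy\big)^{1/\alpha}$ are bounded over all balls $B'\subseteq B(x,r)$. -/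

import Mathlib

open MeasureTheory Metric Set Filter Topology
open scoped ENNReal NNReal ContDiff

/-- `ℝⁿ` with its Euclidean norm. -/
abbrev Rn (n : ℕ) : Type := EuclideanSpace ℝ (Fin n)

/-! ### Function classes for the potentials -/

/-- `f ∈ L^p_loc(ℝⁿ)`. -/
def MemLpLoc {n : ℕ} (p : ℝ) (f : Rn n → ℝ) : Prop :=
  ∀ K : Set (Rn n), IsCompact K → MemLp f (ENNReal.ofReal p) (volume.restrict K)

/-- The generalized Morrey norm
`sup_{x, r > 0} ( φ(r)⁻¹ ∫_{|x-y|<r} |f(y)|^p dy )^{1/p}`, with values in `[0, ∞]`. -/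
noncomputable def morreyNorm {n : ℕ} (p : ℝ) (φ : ℝ → ℝ) (f : Rn n → ℝ) : ℝ≥0∞ :=
  ⨆ (x : Rn n) (r : ℝ) (_ : 0 < r),
    ((∫⁻ y in ball x r, ‖f y‖ₑ ^ p) / ENNReal.ofReal (φ r)) ^ (1 / p)

/-- `f` belongs to the generalized Morrey space `L^{p,φ}(ℝⁿ)`. -/
def MemMorrey {n : ℕ} (p : ℝ) (φ : ℝ → ℝ) (f : Rn n → ℝ) : Prop :=
  MemLpLoc p f ∧ morreyNorm p φ f < ⊤

/-- `φ` is almost increasing on `(0, ∞)`. -/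
def AlmostIncreasing (φ : ℝ → ℝ) : Prop :=
  ∃ C > 0, ∀ s t : ℝ, 0 < s → s ≤ t → φ s ≤ C * φ t

/-- `φ(t) t⁻ⁿ` is almost decreasing on `(0, ∞)`. -/
def AlmostDecreasingDiv (n : ℕ) (φ : ℝ → ℝ) : Prop :=
  ∃ C > 0, ∀ s t : ℝ, 0 < s → s ≤ t → C * (φ t / t ^ n) ≤ φ s / s ^ n

/-- Nakai's condition:
`∫_δ^∞ φ(t) / t^{(n+1) - (p/2)(α+1)} dt ≤ C δ^{(p/2)(1-α)}` for all `δ > 0`. -/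
def NakaiCondition (n : ℕ) (α p : ℝ) (φ : ℝ → ℝ) : Prop :=
  ∃ C > 0, ∀ δ : ℝ, 0 < δ →
    ∫⁻ t in Ioi δ, ENNReal.ofReal (φ t / t ^ (((n : ℝ) + 1) - p / 2 * (α + 1)))
      ≤ ENNReal.ofReal (C * δ ^ (p / 2 * (1 - α)))

/-- The Stummel modulus `η_α V(r) = sup_x ∫_{|x-y|<r} |V(y)| / |x-y|^{n-α} dy`,
with values in `[0, ∞]`. -/
noncomputable def stummelModulus {n : ℕ} (α : ℝ) (V : Rn n → ℝ) (r : ℝ) : ℝ≥0∞ :=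
  ⨆ x : Rn n, ∫⁻ y in ball x r, ‖V y‖ₑ / ‖x - y‖ₑ ^ ((n : ℝ) - α)

/-- `V` belongs to the bounded Stummel modulus class `S̃_α`. -/
def MemStummel {n : ℕ} (α : ℝ) (V : Rn n → ℝ) : Prop :=
  MemLpLoc 1 V ∧ ∀ r : ℝ, 0 < r → stummelModulus α V r < ⊤

/-! ### Sobolev spaces -/

/-- `w ∈ C₀^∞(Ω)`: smooth with compact support contained in `Ω`. -/
structure IsTestFunction {n : ℕ} (Ω : Set (Rn n)) (w : Rn n → ℝ) : Prop where
  smooth : ContDiff ℝ ∞ w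
  compact : HasCompactSupport w
  support : tsupport w ⊆ Ω

/-- `g` is the weak gradient of `u` on `Ω`. -/
def IsWeakGradient {n : ℕ} (Ω : Set (Rn n)) (u : Rn n → ℝ) (g : Rn n → Rn n) : Prop :=
  ∀ w : Rn n → ℝ, IsTestFunction Ω w → ∀ i : Fin n,
    ∫ y in Ω, u y * fderiv ℝ w y (EuclideanSpace.single i 1) = - ∫ y in Ω, g y i * w y

/-- `u ∈ H¹(Ω)` with weak gradient `g` (which is unique up to a null set of `Ω`). -/
structure MemH1 {n : ℕ} (Ω : Set (Rn n)) (u : Rn n → ℝ) (g : Rn n → Rn n) : Prop where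
  memLp : MemLp u 2 (volume.restrict Ω)
  memLp_grad : MemLp g 2 (volume.restrict Ω)
  weakGradient : IsWeakGradient Ω u g

/-- The Sobolev norm `‖u‖_{L²(Ω)} + ∑ᵢ ‖gᵢ‖_{L²(Ω)}` of a function `u` with weak gradient `g`. -/
noncomputable def h1Norm {n : ℕ} (Ω : Set (Rn n)) (u : Rn n → ℝ) (g : Rn n → Rn n) : ℝ≥0∞ :=
  eLpNorm u 2 (volume.restrict Ω) + ∑ i : Fin n, eLpNorm (fun y => g y i) 2 (volume.restrict Ω)

/-- `u ∈ H¹₀(Ω)` with weak gradient `g`: `u` is in `H¹(Ω)` and is the limit in the Sobolev norm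
of a sequence of test functions. -/
def MemH10 {n : ℕ} (Ω : Set (Rn n)) (u : Rn n → ℝ) (g : Rn n → Rn n) : Prop :=
  MemH1 Ω u g ∧ ∃ w : ℕ → Rn n → ℝ, (∀ k, IsTestFunction Ω (w k)) ∧
    Tendsto (fun k => h1Norm Ω (fun y => w k y - u y) (fun y => gradient (w k) y - g y))
      atTop (𝓝 0)

/-! ### The equation -/

/-- The leading coefficients `a_{ij}`: bounded and measurable on `Ω`, symmetric, and
`λ|ξ|² ≤ ∑ a_{ij}(x) ξᵢ ξⱼ ≤ λ⁻¹|ξ|²` for all `ξ` and almost all `x ∈ Ω`. -/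
structure IsElliptic {n : ℕ} (Ω : Set (Rn n)) (lam : ℝ) (a : Fin n → Fin n → Rn n → ℝ) :
    Prop where
  memLp : ∀ i j, MemLp (a i j) ⊤ (volume.restrict Ω)
  symm : ∀ᵐ x ∂(volume.restrict Ω), ∀ i j, a i j x = a j i x
  lower : ∀ᵐ x ∂(volume.restrict Ω), ∀ ξ : Rn n,
    lam * ‖ξ‖ ^ 2 ≤ ∑ i, ∑ j, a i j x * ξ i * ξ j
  upper : ∀ᵐ x ∂(volume.restrict Ω), ∀ ξ : Rn n,
    ∑ i, ∑ j, a i j x * ξ i * ξ j ≤ lam⁻¹ * ‖ξ‖ ^ 2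

/-- `u ∈ H¹₀(Ω)` is a weak solution of
`-∑ ∂ᵢ(a_{ij} ∂ⱼ u) + ∑ bᵢ ∂ᵢ u + V u = 0` in `Ω`, tested against all `ψ ∈ H¹₀(Ω)`. -/
def IsWeakSolution {n : ℕ} (Ω : Set (Rn n)) (a : Fin n → Fin n → Rn n → ℝ)
    (b : Fin n → Rn n → ℝ) (V : Rn n → ℝ) (u : Rn n → ℝ) : Prop :=
  ∃ Du : Rn n → Rn n, MemH10 Ω u Du ∧
    ∀ (ψ : Rn n → ℝ) (Dψ : Rn n → Rn n), MemH10 Ω ψ Dψ →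
      ∫ y in Ω, ((∑ i, ∑ j, a i j y * Du y i * Dψ y j) + (∑ i, b i y * Du y i * ψ y)
        + V y * u y * ψ y) = 0

/-! ### Mean oscillation -/

/-- The mean `α`-oscillation `|B|⁻¹ ∫_B |f - f_B|^α` over `B = B(x, r)`, with values in `[0, ∞]`;
meaningful when `f` is integrable on `B`. -/
noncomputable def meanOsc {n : ℕ} (α : ℝ) (f : Rn n → ℝ) (x : Rn n) (r : ℝ) : ℝ≥0∞ :=
  ⨍⁻ y in ball x r, ENNReal.ofReal (|f y - ⨍ z in ball x r, f z| ^ α) ∂volume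

/-- `f ∈ BMO_α(B)` for the ball `B = B(x, R)`. -/
def MemBMO {n : ℕ} (α : ℝ) (f : Rn n → ℝ) (x : Rn n) (R : ℝ) : Prop :=
  IntegrableOn f (ball x R) ∧
    ∃ C : ℝ, 0 < C ∧ ∀ (y : Rn n) (s : ℝ), 0 < s → ball y s ⊆ ball x R →
      (meanOsc α f y s) ^ (1 / α) ≤ ENNReal.ofReal C

/-! ### A Poincaré inequality on balls -/

/-! This is Moser's logarithmic estimate: testing the equation with `η² / u` bounds the gradient of
`log u` in `L²`, and Poincaré's inequality turns that into a bound on the oscillation.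

The test function used is `ψ = η² (s - u)` with `s = √(δ² + u²)`. The function `t ↦ √(δ² + t²) - t`
is smooth on all of `ℝ` with derivative bounded by `2`, so it can be composed with approximating
test functions, which may change sign even though `u ≥ 0`. For `u ≥ 0` it behaves like `δ² / s`: the
factor `κ = s (s - u)` lies in `[δ²/2, δ²]`. With `X = η Du / s` the leading and drift terms become
`κ (2 A(X, ∇η) - A(X, X) + η b·X)`, and the potential term is at most `δ² η² |V|`. Ellipticity
absorbs the terms linear in `X`, and `δ²` cancels (`energy_integrand_le`, `integral_energy_le`):
`(λ/8) ∫ η² |Du|² / s² ≤ ∫ (2 λ⁻¹ |∇η|² + λ⁻¹ η² |b|² + η² |V|)`.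

Since `1 / s` is the derivative of `arsinh (t / δ)`, this controls the gradient of `arsinh (u / δ)`,
which differs from `log (u + δ) - log δ` by at most `1`. If `bᵢ²` and `V` have integral `O(r^(n-2))`
over balls of radius `2r`, with `r ≤ 1`, a cutoff at scale `r` makes the energy on `B(x, r)` equal
to `O(r^(n-2))`. Poincaré in double-integral form then bounds the double integral of squared
differences of the logarithm by a constant times `|B|²`, and `|t|^α ≤ 1 + t²` gives the
`α`-oscillation (`exists_log_oscillation_bound`).

Both potential classes enter only through these growth bounds. A Stummel bound gives `∫_{B(x,ρ)} |V|
≤ K ρ^(n-α)` because the kernel is at least `ρ^(α-n)` on the ball. In the Morrey case, Nakai's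
condition on one dyadic window forces `φ(ρ) ≤ c ρ^(n-pα)`, and interpolating between `L^p` and
constants gives the same power. As `α ≤ 2` and `r ≤ 1`, `r^(n-α) ≤ r^(n-2)`. -/

theorem sq_lintegral_le {X : Type*} [MeasurableSpace X] (μ : Measure X) {g : X → ℝ≥0∞}
    (hg : AEMeasurable g μ) : (∫⁻ x, g x ∂μ) ^ 2 ≤ μ univ * ∫⁻ x, g x ^ 2 ∂μ := by
  have h := ENNReal.lintegral_mul_le_Lp_mul_Lq μ (p := 2) (q := 2)
    (Real.HolderConjugate.two_two) hg (aemeasurable_const (b := (1 : ℝ≥0∞)))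
  simp only [Pi.mul_apply, mul_one, ENNReal.rpow_two, one_pow, lintegral_one] at h
  calc (∫⁻ x, g x ∂μ) ^ 2
      ≤ ((∫⁻ x, g x ^ 2 ∂μ) ^ ((1 : ℝ) / 2) * μ univ ^ ((1 : ℝ) / 2)) ^ 2 := by gcongr
    _ = μ univ * ∫⁻ x, g x ^ 2 ∂μ := by
      rw [mul_pow, ← ENNReal.rpow_natCast, ← ENNReal.rpow_natCast, ← ENNReal.rpow_mul,
        ← ENNReal.rpow_mul]
      norm_num [mul_comm]

theorem lintegral_comp_add_smul {n : ℕ} (h : Rn n → ℝ≥0∞) (z : Rn n) {t : ℝ} (ht : t ≠ 0) :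
    ∫⁻ y, h (z + t • y) = ENNReal.ofReal |(t ^ n)⁻¹| * ∫⁻ y, h y := by
  have h1 := lintegral_map_equiv (μ := (volume : Measure (Rn n))) (fun y => h (z + y))
    (MeasurableEquiv.smul₀ t ht)
  have h2 := Measure.map_addHaar_smul (volume : Measure (Rn n)) ht
  simp only [finrank_euclideanSpace, Fintype.card_fin] at h2
  simp only [MeasurableEquiv.coe_smul₀] at h1
  rw [← h1, h2, lintegral_smul_measure, lintegral_add_left_eq_self, smul_eq_mul]

/-- By convexity `y ↦ (1 - t) x + t y` maps `B` into itself, and the change of variables costs `t⁻ⁿ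
≤ 2ⁿ` as long as `t ≥ 1/2`. -/
theorem lintegral_segment_le_aux {n : ℕ} {B : Set (Rn n)} (hB : Convex ℝ B)
    (hm : MeasurableSet B) {h : Rn n → ℝ≥0∞} {t : ℝ} (ht : 1 / 2 ≤ t) (ht1 : t ≤ 1)
    {x : Rn n} (hx : x ∈ B) :
    ∫⁻ y in B, h (x + t • (y - x)) ≤ 2 ^ n * ∫⁻ y in B, h y := by
  have ht0 : 0 < t := by linarith
  rw [← lintegral_indicator hm, ← lintegral_indicator hm]
  calc ∫⁻ y, B.indicator (fun y => h (x + t • (y - x))) y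
      ≤ ∫⁻ y, B.indicator h ((1 - t) • x + t • y) := by
        refine lintegral_mono fun y => ?_
        by_cases hy : y ∈ B
        · have e : x + t • (y - x) = (1 - t) • x + t • y := by module
          have hmem : (1 - t) • x + t • y ∈ B :=
            hB hx hy (by linarith) ht0.le (by ring)
          simp only [indicator_of_mem hy, indicator_of_mem hmem, e, le_refl]
        · simp [indicator_of_notMem hy]
    _ = ENNReal.ofReal |(t ^ n)⁻¹| * ∫⁻ y, B.indicator h y :=
        lintegral_comp_add_smul _ _ ht0.ne'
    _ ≤ 2 ^ n * ∫⁻ y, B.indicator h y := by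
        gcongr
        have : |(t ^ n)⁻¹| ≤ 2 ^ n := by
          rw [abs_of_pos (by positivity), ← inv_pow]
          gcongr
          rw [inv_le_comm₀ ht0 (by norm_num)]
          linarith
        calc ENNReal.ofReal |(t ^ n)⁻¹| ≤ ENNReal.ofReal (2 ^ n) := ENNReal.ofReal_le_ofReal this
          _ = 2 ^ n := by rw [ENNReal.ofReal_pow (by norm_num)]; norm_num

theorem lintegral_segment_le {n : ℕ} {B : Set (Rn n)} (hB : Convex ℝ B)
    (hm : MeasurableSet B) {h : Rn n → ℝ≥0∞} (hh : Measurable h) {t : ℝ} (ht : 0 ≤ t)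
    (ht1 : t ≤ 1) :
    ∫⁻ x in B, ∫⁻ y in B, h (x + t • (y - x)) ≤ 2 ^ n * volume B * ∫⁻ y in B, h y := by
  have key : ∀ s : ℝ, 1 / 2 ≤ s → s ≤ 1 →
      ∫⁻ x in B, ∫⁻ y in B, h (x + s • (y - x)) ≤ 2 ^ n * volume B * ∫⁻ y in B, h y := by
    intro s hs hs1
    calc ∫⁻ x in B, ∫⁻ y in B, h (x + s • (y - x))
        ≤ ∫⁻ _ in B, 2 ^ n * ∫⁻ y in B, h y :=
          setLIntegral_mono measurable_const fun x hx => lintegral_segment_le_aux hB hm hs hs1 hx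
      _ = 2 ^ n * volume B * ∫⁻ y in B, h y := by
          rw [setLIntegral_const]; ring
  rcases le_total (1 / 2) t with h1 | h1
  · exact key t h1 ht1
  -- Exchanging `x` and `y` replaces `t` by `1 - t`, so the Jacobian is never taken at a small
  -- parameter.
  · rw [lintegral_lintegral_swap]
    · refine le_trans (le_of_eq ?_) (key (1 - t) (by linarith) (by linarith))
      congr 1 with x
      congr 1 with y
      congr 1
      module
    · exact (hh.comp (by fun_prop)).aemeasurable

theorem enorm_sub_sq_le_lintegral_fderiv {n : ℕ} {w : Rn n → ℝ} (hw : ContDiff ℝ 1 w)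
    (x y : Rn n) : ‖w x - w y‖ₑ ^ 2 ≤
      ‖x - y‖ₑ ^ 2 * ∫⁻ t in Ioc (0 : ℝ) 1, ‖fderiv ℝ w (x + t • (y - x))‖ₑ ^ 2 := by
  have hcf : Continuous (fderiv ℝ w) := hw.continuous_fderiv one_ne_zero
  have hd : ∀ t : ℝ, HasDerivAt (fun t : ℝ => w (x + t • (y - x)))
      (fderiv ℝ w (x + t • (y - x)) (y - x)) t := by
    intro t
    have h1 : HasDerivAt (fun t : ℝ => x + t • (y - x)) (y - x) t := by
      simpa using ((hasDerivAt_id t).smul_const (y - x)).const_add x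
    exact ((hw.differentiable one_ne_zero) _).hasFDerivAt.comp_hasDerivAt t h1
  have hint : w y - w x = ∫ t in (0 : ℝ)..1, fderiv ℝ w (x + t • (y - x)) (y - x) := by
    rw [intervalIntegral.integral_eq_sub_of_hasDerivAt (fun t _ => hd t)]
    · simp
    · exact (by fun_prop : Continuous fun t : ℝ =>
        fderiv ℝ w (x + t • (y - x)) (y - x)).intervalIntegrable _ _
  have h1 : ‖w x - w y‖ₑ ≤
      ‖x - y‖ₑ * ∫⁻ t in Ioc (0 : ℝ) 1, ‖fderiv ℝ w (x + t • (y - x))‖ₑ := by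
    rw [← enorm_neg, neg_sub, hint, intervalIntegral.integral_of_le zero_le_one,
      ← lintegral_const_mul _ (by fun_prop)]
    refine (enorm_integral_le_lintegral_enorm _).trans (lintegral_mono fun t => ?_)
    refine (ContinuousLinearMap.le_opENorm _ _).trans ?_
    rw [mul_comm, ← enorm_neg (x - y), neg_sub]
  calc ‖w x - w y‖ₑ ^ 2
      ≤ (‖x - y‖ₑ * ∫⁻ t in Ioc (0 : ℝ) 1, ‖fderiv ℝ w (x + t • (y - x))‖ₑ) ^ 2 := by gcongr
    _ ≤ _ := by
      rw [mul_pow]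
      gcongr
      refine (sq_lintegral_le _ (by fun_prop)).trans ?_
      simp

/-- A Poincaré inequality in double-integral form. -/
theorem lintegral_lintegral_sub_sq_le {n : ℕ} {w : Rn n → ℝ} (hw : ContDiff ℝ 1 w)
    (c : Rn n) (r : ℝ) :
    ∫⁻ x in ball c r, ∫⁻ y in ball c r, ‖w x - w y‖ₑ ^ 2 ≤
      ENNReal.ofReal (2 * r) ^ 2 * (2 ^ n * volume (ball c r)) *
        ∫⁻ y in ball c r, ‖fderiv ℝ w y‖ₑ ^ 2 := by
  have hcf : Continuous (fderiv ℝ w) := hw.continuous_fderiv one_ne_zero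
  set B := ball c r
  have hmB : MeasurableSet B := measurableSet_ball
  calc ∫⁻ x in B, ∫⁻ y in B, ‖w x - w y‖ₑ ^ 2
      ≤ ∫⁻ x in B, ∫⁻ y in B, ENNReal.ofReal (2 * r) ^ 2 *
          ∫⁻ t in Ioc (0 : ℝ) 1, ‖fderiv ℝ w (x + t • (y - x))‖ₑ ^ 2 := by
        refine setLIntegral_mono' hmB fun x hx => setLIntegral_mono' hmB fun y hy => ?_
        refine (enorm_sub_sq_le_lintegral_fderiv hw x y).trans ?_
        gcongr
        rw [← ofReal_norm, ← dist_eq_norm]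
        apply ENNReal.ofReal_le_ofReal
        have := dist_triangle_right x y c
        have h1 := mem_ball.1 hx
        have h2 := mem_ball.1 hy
        linarith
    _ = ENNReal.ofReal (2 * r) ^ 2 * ∫⁻ t in Ioc (0 : ℝ) 1, ∫⁻ x in B, ∫⁻ y in B,
          ‖fderiv ℝ w (x + t • (y - x))‖ₑ ^ 2 := by
        have hM : ∀ x : Rn n, Measurable fun y => ∫⁻ t in Ioc (0 : ℝ) 1,
            ‖fderiv ℝ w (x + t • (y - x))‖ₑ ^ 2 := fun x =>
          Measurable.lintegral_prod_right'
            (f := fun q : Rn n × ℝ => ‖fderiv ℝ w (x + q.2 • (q.1 - x))‖ₑ ^ 2)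
            (by fun_prop : Continuous _).measurable
        have hM2 : Measurable fun x => ∫⁻ y in B, ∫⁻ t in Ioc (0 : ℝ) 1,
            ‖fderiv ℝ w (x + t • (y - x))‖ₑ ^ 2 :=
          Measurable.lintegral_prod_right'
            (f := fun p : Rn n × Rn n => ∫⁻ t in Ioc (0 : ℝ) 1,
              ‖fderiv ℝ w (p.1 + t • (p.2 - p.1))‖ₑ ^ 2)
            (Measurable.lintegral_prod_right'
              (f := fun q : (Rn n × Rn n) × ℝ =>
                ‖fderiv ℝ w (q.1.1 + q.2 • (q.1.2 - q.1.1))‖ₑ ^ 2)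
              (by fun_prop : Continuous _).measurable)
        have hM3 : Measurable fun q : Rn n × ℝ => ∫⁻ y in B,
            ‖fderiv ℝ w (q.1 + q.2 • (y - q.1))‖ₑ ^ 2 :=
          Measurable.lintegral_prod_right'
            (f := fun q : (Rn n × ℝ) × Rn n => ‖fderiv ℝ w (q.1.1 + q.1.2 • (q.2 - q.1.1))‖ₑ ^ 2)
            (by fun_prop : Continuous _).measurable
        simp_rw [lintegral_const_mul _ (hM _)]
        rw [lintegral_const_mul _ hM2]
        congr 1
        have hsw : ∀ x : Rn n, ∫⁻ y in B, ∫⁻ t in Ioc (0 : ℝ) 1,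
            ‖fderiv ℝ w (x + t • (y - x))‖ₑ ^ 2 = ∫⁻ t in Ioc (0 : ℝ) 1, ∫⁻ y in B,
            ‖fderiv ℝ w (x + t • (y - x))‖ₑ ^ 2 := fun x =>
          lintegral_lintegral_swap (by fun_prop : Continuous fun q : Rn n × ℝ =>
            ‖fderiv ℝ w (x + q.2 • (q.1 - x))‖ₑ ^ 2).measurable.aemeasurable
        simp_rw [hsw]
        exact lintegral_lintegral_swap (f := fun (x : Rn n) (t : ℝ) => ∫⁻ y in B,
            ‖fderiv ℝ w (x + t • (y - x))‖ₑ ^ 2) hM3.aemeasurable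
    _ ≤ ENNReal.ofReal (2 * r) ^ 2 * ∫⁻ t in Ioc (0 : ℝ) 1, 2 ^ n * volume B *
          ∫⁻ y in B, ‖fderiv ℝ w y‖ₑ ^ 2 := by
        refine mul_le_mul_right ?_ _
        refine setLIntegral_mono' measurableSet_Ioc fun t ht => ?_
        exact lintegral_segment_le (convex_ball c r) hmB
          (h := fun z => ‖fderiv ℝ w z‖ₑ ^ 2) (by fun_prop) ht.1.le ht.2
    _ = _ := by
        rw [setLIntegral_const]
        simp [mul_assoc]

/-! ### Pointwise energy inequalities -/

theorem two_mul_form_le {n : ℕ} {A : Fin n → Fin n → ℝ} (hsymm : ∀ i j, A i j = A j i)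
    (hpos : ∀ ξ : Rn n, 0 ≤ ∑ i, ∑ j, A i j * ξ i * ξ j) (X Y : Rn n) :
    2 * ∑ i, ∑ j, A i j * X i * Y j ≤
      (∑ i, ∑ j, A i j * X i * X j) / 2 + 2 * ∑ i, ∑ j, A i j * Y i * Y j := by
  -- Half of the form at `X - 2Y`, expanded, is exactly the claimed inequality.
  have h := hpos (X - (2 : ℝ) • Y)
  have hs : ∑ i, ∑ j, A i j * Y i * X j = ∑ i, ∑ j, A i j * X i * Y j := by
    rw [Finset.sum_comm]
    refine Finset.sum_congr rfl fun i _ => Finset.sum_congr rfl fun j _ => ?_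
    rw [hsymm j i]; ring
  have e : ∑ i, ∑ j, A i j * (X - (2 : ℝ) • Y) i * (X - (2 : ℝ) • Y) j =
      ∑ i, ∑ j, A i j * X i * X j - 2 * ∑ i, ∑ j, A i j * X i * Y j
        - 2 * ∑ i, ∑ j, A i j * Y i * X j + 4 * ∑ i, ∑ j, A i j * Y i * Y j := by
    simp only [Finset.mul_sum, ← Finset.sum_sub_distrib, ← Finset.sum_add_distrib]
    refine Finset.sum_congr rfl fun i _ => Finset.sum_congr rfl fun j _ => ?_
    simp only [PiLp.sub_apply, PiLp.smul_apply, smul_eq_mul]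
    ring
  rw [e, hs] at h
  linarith

/-- The cross term uses up half of `A(X, X)`, leaving `-(λ/2) |X|²`; the drift, by completing
squares, uses another `λ/4`. -/
theorem energy_form_le {n : ℕ} {A : Fin n → Fin n → ℝ} {lam : ℝ} (hlam : 0 < lam)
    (hsymm : ∀ i j, A i j = A j i)
    (hlow : ∀ ξ : Rn n, lam * ‖ξ‖ ^ 2 ≤ ∑ i, ∑ j, A i j * ξ i * ξ j)
    (hup : ∀ ξ : Rn n, ∑ i, ∑ j, A i j * ξ i * ξ j ≤ lam⁻¹ * ‖ξ‖ ^ 2)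
    (b : Fin n → ℝ) (η : ℝ) (X Y : Rn n) :
    2 * (∑ i, ∑ j, A i j * X i * Y j) - (∑ i, ∑ j, A i j * X i * X j) + η * ∑ i, b i * X i ≤
      -(lam / 4) * ‖X‖ ^ 2 + (2 * lam⁻¹ * ‖Y‖ ^ 2 + lam⁻¹ * (η ^ 2 * ∑ i, b i ^ 2)) := by
  have h1 := two_mul_form_le hsymm
    (fun ξ => (by positivity : (0 : ℝ) ≤ lam * ‖ξ‖ ^ 2).trans (hlow ξ)) X Y
  have h2 := hlow X
  have h3 := hup Y
  have h4 : η * ∑ i, b i * X i ≤ lam / 4 * ‖X‖ ^ 2 + lam⁻¹ * (η ^ 2 * ∑ i, b i ^ 2) := by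
    rw [EuclideanSpace.real_norm_sq_eq]
    simp only [Finset.mul_sum, ← Finset.sum_add_distrib]
    refine Finset.sum_le_sum fun i _ => ?_
    have : 0 ≤ lam⁻¹ * (lam / 2 * X i - η * b i) ^ 2 := by positivity
    have e : lam⁻¹ * (lam / 2 * X i - η * b i) ^ 2 =
      lam / 4 * X i ^ 2 + lam⁻¹ * (η ^ 2 * b i ^ 2) - η * (b i * X i) := by
      field_simp; ring
    linarith
  linarith

theorem energy_integrand_le {n : ℕ} {A : Fin n → Fin n → ℝ} {lam : ℝ} (hlam : 0 < lam)
    (hsymm : ∀ i j, A i j = A j i)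
    (hlow : ∀ ξ : Rn n, lam * ‖ξ‖ ^ 2 ≤ ∑ i, ∑ j, A i j * ξ i * ξ j)
    (hup : ∀ ξ : Rn n, ∑ i, ∑ j, A i j * ξ i * ξ j ≤ lam⁻¹ * ‖ξ‖ ^ 2)
    (b : Fin n → ℝ) (V η : ℝ) (D Y : Rn n) {u δ s : ℝ} (hu : 0 ≤ u) (hδ : 0 < δ)
    (hs : s = √(δ ^ 2 + u ^ 2)) :
    (∑ i, ∑ j, A i j * D i * ((s - u) • ((2 * η) • Y) + (η ^ 2 * (u / s - 1)) • D) j)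
      + (∑ i, b i * D i * (η ^ 2 * (s - u))) + V * u * (η ^ 2 * (s - u)) ≤
      δ ^ 2 * (-(lam / 8) * (η / s * ‖D‖) ^ 2 + (2 * lam⁻¹ * ‖Y‖ ^ 2
        + lam⁻¹ * (η ^ 2 * ∑ i, b i ^ 2) + η ^ 2 * |V|)) := by
  have hs0 : 0 < s := hs ▸ Real.sqrt_pos.2 (by positivity)
  have hs2 : s ^ 2 = δ ^ 2 + u ^ 2 := by rw [hs, Real.sq_sqrt (by positivity)]
  have hsu : u ≤ s := by nlinarith
  set κ := s * (s - u) with hκ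
  -- `κ - δ²/2 = (s - u)² / 2`, while `δ² - κ = u (s - u)`; the upper bound is where `u ≥ 0` enters.
  have hκ1 : δ ^ 2 / 2 ≤ κ := by nlinarith [sq_nonneg (s - u)]
  have hκ2 : κ ≤ δ ^ 2 := by nlinarith
  have h := energy_form_le hlam hsymm hlow hup b η ((η / s) • D) Y
  have e1 : (∑ i, ∑ j, A i j * D i * ((s - u) • ((2 * η) • Y) + (η ^ 2 * (u / s - 1)) • D) j) =
      κ * (2 * (∑ i, ∑ j, A i j * ((η / s) • D) i * Y j) -
        ∑ i, ∑ j, A i j * ((η / s) • D) i * ((η / s) • D) j) := by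
    simp only [Finset.mul_sum, ← Finset.sum_sub_distrib]
    refine Finset.sum_congr rfl fun i _ => Finset.sum_congr rfl fun j _ => ?_
    simp only [PiLp.add_apply, PiLp.smul_apply, smul_eq_mul, hκ]
    field_simp
    ring
  have e2 : (∑ i, b i * D i * (η ^ 2 * (s - u))) = κ * (η * ∑ i, b i * ((η / s) • D) i) := by
    simp only [Finset.mul_sum]
    refine Finset.sum_congr rfl fun i _ => ?_
    simp only [PiLp.smul_apply, smul_eq_mul, hκ]
    field_simp
  have hX : ‖(η / s) • D‖ ^ 2 = (η / s * ‖D‖) ^ 2 := by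
    rw [norm_smul, mul_pow, mul_pow, Real.norm_eq_abs, sq_abs]
  have e3 : V * u * (η ^ 2 * (s - u)) ≤ δ ^ 2 * (η ^ 2 * |V|) := by
    have h1 : u * (s - u) ≤ δ ^ 2 := by nlinarith
    have h0 : 0 ≤ u * (s - u) := mul_nonneg hu (by linarith)
    calc V * u * (η ^ 2 * (s - u)) = V * (η ^ 2 * (u * (s - u))) := by ring
      _ ≤ |V| * (η ^ 2 * δ ^ 2) := by
        refine (le_abs_self _).trans ?_
        rw [abs_mul, abs_of_nonneg (by positivity : 0 ≤ η ^ 2 * (u * (s - u)))]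
        gcongr
      _ = δ ^ 2 * (η ^ 2 * |V|) := by ring
  rw [e1, e2, ← mul_add]
  rw [hX] at h
  set P := 2 * lam⁻¹ * ‖Y‖ ^ 2 + lam⁻¹ * (η ^ 2 * ∑ i, b i ^ 2)
  have hP : 0 ≤ P := by positivity
  set Z := (η / s * ‖D‖) ^ 2
  have hZ : 0 ≤ Z := sq_nonneg _
  have hκ0 : 0 ≤ κ := by positivity
  have h5 := mul_le_mul_of_nonneg_left h hκ0
  -- The lower bound on `κ` serves the negative term, halving `λ/4` to `λ/8`; the upper bound serves
  -- `P`.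
  have h6 : κ * (-(lam / 4) * Z + P) ≤ δ ^ 2 * (-(lam / 8) * Z + P) := by
    have := mul_nonneg hlam.le hZ
    nlinarith
  linarith

/-! ### Convergence in `L²` -/

theorem eLpNorm_two_sq {X E : Type*} [MeasurableSpace X] [NormedAddCommGroup E] (μ : Measure X)
    (f : X → E) : eLpNorm f 2 μ ^ 2 = ∫⁻ x, ‖f x‖ₑ ^ 2 ∂μ := by
  have h := eLpNorm_nnreal_pow_eq_lintegral (μ := μ) (f := f) (p := 2) two_ne_zero
  have e : ((2 : ℝ≥0) : ℝ) = ((2 : ℕ) : ℝ) := by norm_num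
  rw [e] at h
  simp only [ENNReal.rpow_natCast] at h
  exact h

theorem tendsto_eLpNorm_two_zero_of_dominated {X E F : Type*} [MeasurableSpace X]
    [NormedAddCommGroup E] [NormedAddCommGroup F] {μ : Measure X} {f : ℕ → X → E} {g : X → F}
    (hf : ∀ k, AEStronglyMeasurable (f k) μ) (hg : MemLp g 2 μ)
    (hb : ∀ k, ∀ᵐ x ∂μ, ‖f k x‖ ≤ ‖g x‖)
    (hlim : ∀ᵐ x ∂μ, Tendsto (fun k => f k x) atTop (𝓝 0)) :
    Tendsto (fun k => eLpNorm (f k) 2 μ) atTop (𝓝 0) := by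
  have h : Tendsto (fun k => ∫⁻ x, ‖f k x‖ₑ ^ 2 ∂μ) atTop (𝓝 (∫⁻ _, 0 ∂μ)) := by
    refine tendsto_lintegral_of_dominated_convergence' (fun x => ‖g x‖ₑ ^ 2)
      (fun k => (hf k).enorm.pow_const 2) (fun k => ?_) ?_ ?_
    · filter_upwards [hb k] with x hx
      have := enorm_le_iff_norm_le.2 hx
      gcongr
    · rw [← eLpNorm_two_sq]
      exact ENNReal.pow_ne_top hg.2.ne
    · filter_upwards [hlim] with x hx
      have := ((ENNReal.continuous_pow 2).tendsto _).comp hx.enorm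
      simpa [Function.comp_def] using this
  simp_rw [← eLpNorm_two_sq, lintegral_zero] at h
  have h2 := ((ENNReal.continuous_rpow_const (y := 1 / 2)).tendsto _).comp h
  simp only [Function.comp_def, ← ENNReal.rpow_natCast, ← ENNReal.rpow_mul] at h2
  norm_num at h2
  exact h2

/-- Split the difference as `H(w_k) (D_k - D₀) + (H(w_k) - H(u)) D₀`: the first part is small since
`H` is bounded, the second by dominated convergence. This passes chain-rule gradients to the limit.
-/
theorem tendsto_eLpNorm_comp_smul {X E : Type*} [MeasurableSpace X] [NormedAddCommGroup E]
    [NormedSpace ℝ E] {μ : Measure X} {w : ℕ → X → ℝ} {u : X → ℝ} {D : ℕ → X → E} {D₀ : X → E}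
    {H : ℝ → ℝ} (hH : Continuous H) {M : ℝ} (hM : ∀ t, |H t| ≤ M)
    (hw : ∀ k, AEStronglyMeasurable (w k) μ) (hu : AEStronglyMeasurable u μ)
    (hD : ∀ k, AEStronglyMeasurable (D k) μ) (hD₀ : MemLp D₀ 2 μ)
    (hae : ∀ᵐ x ∂μ, Tendsto (fun k => w k x) atTop (𝓝 (u x)))
    (hlim : Tendsto (fun k => eLpNorm (fun x => D k x - D₀ x) 2 μ) atTop (𝓝 0)) :
    Tendsto (fun k => eLpNorm (fun x => H (w k x) • D k x - H (u x) • D₀ x) 2 μ)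
      atTop (𝓝 0) := by
  have hM0 : 0 ≤ M := (abs_nonneg _).trans (hM 0)
  have h1 : Tendsto (fun k => eLpNorm (fun x => H (w k x) • (D k x - D₀ x)) 2 μ)
      atTop (𝓝 0) := by
    have h2 : Tendsto (fun k => ENNReal.ofReal M * eLpNorm (fun x => D k x - D₀ x) 2 μ)
        atTop (𝓝 0) := by
      simpa using ENNReal.Tendsto.const_mul hlim (Or.inr ENNReal.ofReal_ne_top)
    refine tendsto_of_tendsto_of_tendsto_of_le_of_le tendsto_const_nhds h2
      (fun _ => zero_le) fun k => ?_
    refine eLpNorm_le_mul_eLpNorm_of_ae_le_mul (Eventually.of_forall fun x => ?_) 2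
    rw [norm_smul]
    gcongr
    exact hM _
  have h2 : Tendsto (fun k => eLpNorm (fun x => (H (w k x) - H (u x)) • D₀ x) 2 μ)
      atTop (𝓝 0) := by
    refine tendsto_eLpNorm_two_zero_of_dominated (g := fun x => (2 * M) • D₀ x)
      (fun k => ?_) (hD₀.const_smul _) (fun k => Eventually.of_forall fun x => ?_) ?_
    · exact ((hH.comp_aestronglyMeasurable (hw k)).sub
        (hH.comp_aestronglyMeasurable hu)).smul hD₀.1
    · rw [norm_smul, norm_smul]
      refine mul_le_mul_of_nonneg_right ?_ (norm_nonneg _)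
      rw [Real.norm_of_nonneg (by linarith : 0 ≤ 2 * M), Real.norm_eq_abs]
      have := abs_sub (H (w k x)) (H (u x))
      linarith [hM (w k x), hM (u x)]
    · filter_upwards [hae] with x hx
      have := (((hH.tendsto _).comp hx).sub_const (H (u x))).smul_const (D₀ x)
      simpa using this
  have h3 := h1.add h2
  rw [add_zero] at h3
  refine tendsto_of_tendsto_of_tendsto_of_le_of_le tendsto_const_nhds h3
    (fun _ => zero_le) fun k => ?_
  have e : (fun x => H (w k x) • D k x - H (u x) • D₀ x) =
      (fun x => H (w k x) • (D k x - D₀ x)) + fun x => (H (w k x) - H (u x)) • D₀ x := by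
    ext x
    simp only [Pi.add_apply]
    module
  rw [e]
  refine eLpNorm_add_le ?_ ?_ one_le_two
  · exact (hH.comp_aestronglyMeasurable (hw k)).smul ((hD k).sub hD₀.1)
  · exact ((hH.comp_aestronglyMeasurable (hw k)).sub
        (hH.comp_aestronglyMeasurable hu)).smul hD₀.1

theorem tendsto_integral_mul_of_tendsto_eLpNorm_two {X : Type*} [MeasurableSpace X]
    {μ : Measure X} {f : ℕ → X → ℝ} {f₀ h : X → ℝ} (hf : ∀ k, MemLp (f k) 2 μ)
    (hf₀ : MemLp f₀ 2 μ) (hh : MemLp h 2 μ)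
    (hlim : Tendsto (fun k => eLpNorm (fun x => f k x - f₀ x) 2 μ) atTop (𝓝 0)) :
    Tendsto (fun k => ∫ x, f k x * h x ∂μ) atTop (𝓝 (∫ x, f₀ x * h x ∂μ)) := by
  refine tendsto_integral_of_L1 _ (hf₀.integrable_mul hh).1
    (Eventually.of_forall fun k => (hf k).integrable_mul hh) ?_
  have h2 : Tendsto (fun k => eLpNorm (fun x => f k x - f₀ x) 2 μ * eLpNorm h 2 μ)
      atTop (𝓝 0) := by
    simpa using ENNReal.Tendsto.mul_const hlim (Or.inr hh.2.ne)
  refine tendsto_of_tendsto_of_tendsto_of_le_of_le tendsto_const_nhds h2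
      (fun _ => zero_le) fun k => ?_
  have := eLpNorm_smul_le_mul_eLpNorm (p := 2) (q := 2) (r := 1) (μ := μ) hh.1
    ((hf k).sub hf₀).1
  rw [eLpNorm_one_eq_lintegral_enorm] at this
  refine (le_of_eq ?_).trans this
  congr 1 with x
  simp [sub_mul]

/-! ### Sobolev functions and composition -/

theorem gradient_apply {n : ℕ} (w : Rn n → ℝ) (y : Rn n) (i : Fin n) :
    gradient w y i = fderiv ℝ w y (EuclideanSpace.single i 1) := by
  have h : inner ℝ (gradient w y) (EuclideanSpace.single i (1 : ℝ)) =
      fderiv ℝ w y (EuclideanSpace.single i 1) := by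
    simp [gradient]
  rw [← h, EuclideanSpace.inner_single_right]
  simp

theorem norm_le_sum_abs {n : ℕ} (v : Rn n) : ‖v‖ ≤ ∑ i, |v i| := by
  have h := (EuclideanSpace.basisFun (Fin n) ℝ).sum_repr v
  calc ‖v‖ = ‖∑ i, (EuclideanSpace.basisFun (Fin n) ℝ).repr v i •
        EuclideanSpace.basisFun (Fin n) ℝ i‖ := by rw [h]
    _ ≤ ∑ i, |v i| := by
      refine (norm_sum_le _ _).trans (Finset.sum_le_sum fun i _ => ?_)
      simp [norm_smul]

theorem eLpNorm_le_sum_components {n : ℕ} {μ : Measure (Rn n)} {g : Rn n → Rn n}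
    (hg : AEStronglyMeasurable g μ) :
    eLpNorm g 2 μ ≤ ∑ i : Fin n, eLpNorm (fun y => g y i) 2 μ := by
  have hm : ∀ i : Fin n, AEStronglyMeasurable (fun y => g y i) μ := fun i =>
    (by fun_prop : Continuous fun v : Rn n => v i).comp_aestronglyMeasurable hg
  calc eLpNorm g 2 μ ≤ eLpNorm (∑ i : Fin n, fun y => ‖g y i‖) 2 μ := by
        refine eLpNorm_mono_real fun y => ?_
        rw [Finset.sum_apply]
        exact norm_le_sum_abs _
    _ ≤ ∑ i : Fin n, eLpNorm (fun y => ‖g y i‖) 2 μ :=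
        eLpNorm_sum_le (fun i _ => (hm i).norm) one_le_two
    _ = _ := by simp only [eLpNorm_norm]

theorem eLpNorm_component_le {n : ℕ} {μ : Measure (Rn n)} (g : Rn n → Rn n) (i : Fin n) :
    eLpNorm (fun y => g y i) 2 μ ≤ eLpNorm g 2 μ :=
  eLpNorm_mono fun y => PiLp.norm_apply_le (g y) i

theorem memLp_component {n : ℕ} {μ : Measure (Rn n)} {g : Rn n → Rn n} (hg : MemLp g 2 μ)
    (i : Fin n) : MemLp (fun y => g y i) 2 μ :=
  ⟨(by fun_prop : Continuous fun v : Rn n => v i).comp_aestronglyMeasurable hg.1,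
    (eLpNorm_component_le g i).trans_lt hg.2⟩

theorem continuous_gradient {n : ℕ} {w : Rn n → ℝ} (hw : ContDiff ℝ ∞ w) :
    Continuous (gradient w) :=
  (InnerProductSpace.toDual ℝ (Rn n)).symm.continuous.comp
    (hw.continuous_fderiv (by simp))

theorem norm_gradient {n : ℕ} (w : Rn n → ℝ) (y : Rn n) : ‖gradient w y‖ = ‖fderiv ℝ w y‖ := by
  simp [gradient]

theorem enorm_gradient {n : ℕ} (w : Rn n → ℝ) (y : Rn n) :
    ‖gradient w y‖ₑ = ‖fderiv ℝ w y‖ₑ := by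
  rw [← ofReal_norm, norm_gradient, ofReal_norm]

theorem support_gradient_subset {n : ℕ} (w : Rn n → ℝ) :
    Function.support (gradient w) ⊆ tsupport w := by
  intro y hy
  refine support_fderiv_subset ℝ (f := w) ?_
  simp only [Function.mem_support] at hy ⊢
  intro h
  exact hy (by simp [gradient, h])

theorem IsTestFunction.memLp {n : ℕ} {Ω : Set (Rn n)} {w : Rn n → ℝ} (hw : IsTestFunction Ω w)
    (μ : Measure (Rn n)) [IsFiniteMeasureOnCompacts μ] (p : ℝ≥0∞) : MemLp w p μ :=
  hw.smooth.continuous.memLp_of_hasCompactSupport hw.compact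

theorem IsTestFunction.memLp_gradient {n : ℕ} {Ω : Set (Rn n)} {w : Rn n → ℝ}
    (hw : IsTestFunction Ω w) (μ : Measure (Rn n)) [IsFiniteMeasureOnCompacts μ] (p : ℝ≥0∞) :
    MemLp (gradient w) p μ :=
  (continuous_gradient hw.smooth).memLp_of_hasCompactSupport
    (hw.compact.mono' (support_gradient_subset w))

theorem MemH10.exists_seq {n : ℕ} {Ω : Set (Rn n)} {u : Rn n → ℝ} {Du : Rn n → Rn n}
    (h : MemH10 Ω u Du) : ∃ w : ℕ → Rn n → ℝ, (∀ k, IsTestFunction Ω (w k)) ∧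
      (∀ᵐ y ∂(volume.restrict Ω), Tendsto (fun k => w k y) atTop (𝓝 (u y))) ∧
      Tendsto (fun k => eLpNorm (fun y => w k y - u y) 2 (volume.restrict Ω)) atTop (𝓝 0) ∧
      Tendsto (fun k => eLpNorm (fun y => gradient (w k) y - Du y) 2 (volume.restrict Ω))
        atTop (𝓝 0) := by
  obtain ⟨hu, w, hw, hlim⟩ := h
  have h1 : Tendsto (fun k => eLpNorm (fun y => w k y - u y) 2 (volume.restrict Ω)) atTop
      (𝓝 0) :=
    tendsto_of_tendsto_of_tendsto_of_le_of_le tendsto_const_nhds hlim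
      (fun _ => zero_le) fun k => le_self_add
  have h2 : Tendsto (fun k => eLpNorm (fun y => gradient (w k) y - Du y) 2 (volume.restrict Ω))
      atTop (𝓝 0) := by
    refine tendsto_of_tendsto_of_tendsto_of_le_of_le tendsto_const_nhds hlim
      (fun _ => zero_le) fun k => ?_
    refine (eLpNorm_le_sum_components ?_).trans le_add_self
    exact (continuous_gradient (hw k).smooth).aestronglyMeasurable.sub hu.memLp_grad.1
  -- Norm convergence yields only a subsequence converging almost everywhere; both norm limits
  -- survive along it.
  obtain ⟨ns, hns, hae⟩ := (tendstoInMeasure_of_tendsto_eLpNorm (f := w) (g := u) two_ne_zero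
    (fun k => (hw k).smooth.continuous.aestronglyMeasurable) hu.memLp.1 h1).exists_seq_tendsto_ae
  exact ⟨fun k => w (ns k), fun k => hw _, hae, h1.comp hns.tendsto_atTop,
    h2.comp hns.tendsto_atTop⟩

theorem IsTestFunction.setIntegral_mul_fderiv {n : ℕ} {Ω : Set (Rn n)} {v w : Rn n → ℝ}
    (hv : IsTestFunction Ω v) (hw : IsTestFunction Ω w) (i : Fin n) :
    ∫ y in Ω, v y * fderiv ℝ w y (EuclideanSpace.single i 1) =
      - ∫ y in Ω, gradient v y i * w y := by
  have hcv := hv.smooth.continuous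
  have hcw := hw.smooth.continuous
  have hdv : Continuous (fderiv ℝ v) := hv.smooth.continuous_fderiv (by simp)
  have hdw : Continuous (fderiv ℝ w) := hw.smooth.continuous_fderiv (by simp)
  have hz : ∀ y, y ∉ Ω → v y = 0 := fun y hy =>
    image_eq_zero_of_notMem_tsupport fun h => hy (hv.support h)
  have hz' : ∀ y, y ∉ Ω → w y = 0 := fun y hy =>
    image_eq_zero_of_notMem_tsupport fun h => hy (hw.support h)
  rw [setIntegral_eq_integral_of_forall_compl_eq_zero fun y hy => by rw [hz y hy, zero_mul],
    setIntegral_eq_integral_of_forall_compl_eq_zero fun y hy => by rw [hz' y hy, mul_zero]]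
  simp_rw [gradient_apply]
  apply integral_mul_fderiv_eq_neg_fderiv_mul_of_integrable
  · exact (by fun_prop : Continuous fun y =>
      fderiv ℝ v y (EuclideanSpace.single i 1) * w y).integrable_of_hasCompactSupport
      hw.compact.mul_left
  · exact (by fun_prop : Continuous fun y =>
      v y * fderiv ℝ w y (EuclideanSpace.single i 1)).integrable_of_hasCompactSupport
      hv.compact.mul_right
  · exact (by fun_prop : Continuous fun y => v y * w y).integrable_of_hasCompactSupport
      hv.compact.mul_right
  · exact fun y _ => hv.smooth.differentiable (by simp) y
  · exact fun y _ => hw.smooth.differentiable (by simp) y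

/-- Integration by parts holds for each `v k`, and pairing with a fixed test function is continuous
in `L²`, so the limit inherits its weak gradient. -/
theorem memH10_of_tendsto {n : ℕ} {Ω : Set (Rn n)} {ψ : Rn n → ℝ} {g : Rn n → Rn n}
    {v : ℕ → Rn n → ℝ} (hv : ∀ k, IsTestFunction Ω (v k))
    (hψ : MemLp ψ 2 (volume.restrict Ω)) (hg : MemLp g 2 (volume.restrict Ω))
    (h1 : Tendsto (fun k => eLpNorm (fun y => v k y - ψ y) 2 (volume.restrict Ω)) atTop (𝓝 0))
    (h2 : Tendsto (fun k => eLpNorm (fun y => gradient (v k) y - g y) 2 (volume.restrict Ω))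
      atTop (𝓝 0)) : MemH10 Ω ψ g := by
  have h3 : ∀ i : Fin n, Tendsto (fun k => eLpNorm (fun y => (gradient (v k) y - g y) i) 2
      (volume.restrict Ω)) atTop (𝓝 0) := fun i =>
    tendsto_of_tendsto_of_tendsto_of_le_of_le tendsto_const_nhds h2
      (fun _ => zero_le) fun k => eLpNorm_component_le _ i
  refine ⟨⟨hψ, hg, fun w hw i => ?_⟩, v, hv, ?_⟩
  · have hdw : Continuous (fderiv ℝ w) := hw.smooth.continuous_fderiv (by simp)
    have hw' : MemLp (fun y => fderiv ℝ w y (EuclideanSpace.single i 1)) 2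
        (volume.restrict Ω) := by
      simpa only [gradient_apply] using memLp_component (hw.memLp_gradient (volume.restrict Ω) 2) i
    have t1 := tendsto_integral_mul_of_tendsto_eLpNorm_two (fun k => (hv k).memLp _ 2) hψ hw' h1
    have t2 := tendsto_integral_mul_of_tendsto_eLpNorm_two
      (fun k => memLp_component ((hv k).memLp_gradient (volume.restrict Ω) 2) i)
      (memLp_component hg i) (hw.memLp (volume.restrict Ω) 2) (h3 i)
    simp_rw [fun k => (hv k).setIntegral_mul_fderiv hw i] at t1
    exact tendsto_nhds_unique t1 t2.neg
  · have := h1.add (tendsto_finsetSum Finset.univ fun i _ => h3 i)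
    simpa [h1Norm] using this

theorem IsTestFunction.mul_comp {n : ℕ} {Ω : Set (Rn n)} {ζ w : Rn n → ℝ} {G : ℝ → ℝ}
    (hζ : IsTestFunction Ω ζ) (hw : ContDiff ℝ ∞ w) (hG : ContDiff ℝ ∞ G) :
    IsTestFunction Ω (fun y => ζ y * G (w y)) where
  smooth := hζ.smooth.mul (hG.comp hw)
  compact := hζ.compact.mul_right
  support := (tsupport_mul_subset_left (f := ζ) (g := fun y => G (w y))).trans hζ.support

theorem gradient_mul_comp {n : ℕ} {ζ w : Rn n → ℝ} {G : ℝ → ℝ}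
    (hζ : ContDiff ℝ ∞ ζ) (hw : ContDiff ℝ ∞ w) (hG : ContDiff ℝ ∞ G) (y : Rn n) :
    gradient (fun y => ζ y * G (w y)) y =
      G (w y) • gradient ζ y + (ζ y * deriv G (w y)) • gradient w y := by
  have h1 := (hζ.differentiable (by simp) y).hasFDerivAt
  have h2 := (hw.differentiable (by simp) y).hasFDerivAt
  have h3 := (hG.differentiable (by simp) (w y)).hasDerivAt
  have h4 := (h1.mul (h3.comp_hasFDerivAt y h2)).fderiv
  simp only [Pi.mul_def, Function.comp_def] at h4
  simp only [gradient, h4, map_add, map_smul, smul_smul]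
  exact add_comm _ _

theorem gradient_comp {n : ℕ} {w : Rn n → ℝ} {F : ℝ → ℝ}
    (hw : ContDiff ℝ ∞ w) (hF : ContDiff ℝ ∞ F) (y : Rn n) :
    gradient (fun y => F (w y)) y = deriv F (w y) • gradient w y := by
  have h2 := (hw.differentiable (by simp) y).hasFDerivAt
  have h3 := (hF.differentiable (by simp) (w y)).hasDerivAt
  have h4 := (h3.comp_hasFDerivAt y h2).fderiv
  simp only [Function.comp_def] at h4
  simp only [gradient, h4, map_smul]

theorem abs_sub_le_of_abs_deriv_le {G : ℝ → ℝ} (hG : ContDiff ℝ ∞ G) {M : ℝ}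
    (hM : ∀ t, |deriv G t| ≤ M) (s t : ℝ) : |G s - G t| ≤ M * |s - t| :=
  Convex.norm_image_sub_le_of_norm_deriv_le (s := univ)
    (fun x _ => hG.differentiable (by simp) x) (fun x _ => hM x) convex_univ
    (mem_univ t) (mem_univ s)

theorem tendsto_eLpNorm_of_norm_le_mul {X E F : Type*} [MeasurableSpace X]
    [NormedAddCommGroup E] [NormedAddCommGroup F] {μ : Measure X} {f : ℕ → X → E}
    {g : ℕ → X → F} {C : ℝ} (h : ∀ k x, ‖f k x‖ ≤ C * ‖g k x‖)
    (hg : Tendsto (fun k => eLpNorm (g k) 2 μ) atTop (𝓝 0)) :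
    Tendsto (fun k => eLpNorm (f k) 2 μ) atTop (𝓝 0) := by
  have h2 : Tendsto (fun k => ENNReal.ofReal C * eLpNorm (g k) 2 μ) atTop (𝓝 0) := by
    simpa using ENNReal.Tendsto.const_mul hg (Or.inr ENNReal.ofReal_ne_top)
  exact tendsto_of_tendsto_of_tendsto_of_le_of_le tendsto_const_nhds h2 (fun _ => zero_le)
    fun k => eLpNorm_le_mul_eLpNorm_of_ae_le_mul (Eventually.of_forall (h k)) 2

/-- `G` need not be bounded: `|G(u) - G(0)| ≤ M |u|` handles the growth, and the constant `G(0)` is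
multiplied by a square-integrable `ζ`. -/
theorem memLp_comp_smul {n : ℕ} {E : Type*} [NormedAddCommGroup E] [NormedSpace ℝ E]
    {μ : Measure (Rn n)} {u : Rn n → ℝ} {ζ : Rn n → E} {G : ℝ → ℝ} (hG : ContDiff ℝ ∞ G) {M : ℝ}
    (hM : ∀ t, |deriv G t| ≤ M) (hu : MemLp u 2 μ) (hζ : MemLp ζ 2 μ) {C : ℝ}
    (hC : ∀ y, ‖ζ y‖ ≤ C) : MemLp (fun y => G (u y) • ζ y) 2 μ := by
  have h1 : MemLp (fun y => (G (u y) - G 0) • ζ y) 2 μ := by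
    refine MemLp.of_le_mul (c := M * C) hu ?_ (Eventually.of_forall fun y => ?_)
    · exact ((hG.continuous.comp_aestronglyMeasurable hu.1).sub
        aestronglyMeasurable_const).smul hζ.1
    · have h2 := abs_sub_le_of_abs_deriv_le hG hM (u y) 0
      rw [sub_zero] at h2
      rw [norm_smul, Real.norm_eq_abs, Real.norm_eq_abs]
      calc |G (u y) - G 0| * ‖ζ y‖ ≤ (M * |u y|) * C :=
            mul_le_mul h2 (hC y) (norm_nonneg _) ((abs_nonneg _).trans h2)
        _ = M * C * |u y| := by ring
  have h2 := h1.add (hζ.const_smul (G 0))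
  refine h2.congr_norm ?_ ?_
  · exact (hG.continuous.comp_aestronglyMeasurable hu.1).smul hζ.1
  · refine Eventually.of_forall fun y => ?_
    simp only [Pi.add_apply, Pi.smul_apply]
    congr 1
    module

/-- The approximants are `ζ · G(w_k)`; the factor `ζ` keeps their support compact in `Ω` even when
`G(0) ≠ 0`. This is what makes `η² (s - u)` admissible. -/
theorem MemH10.testFunction_mul_comp {n : ℕ} {Ω : Set (Rn n)} {u ζ : Rn n → ℝ}
    {Du : Rn n → Rn n} {G : ℝ → ℝ} (h : MemH10 Ω u Du) (hζ : IsTestFunction Ω ζ)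
    (hG : ContDiff ℝ ∞ G) {M : ℝ} (hM : ∀ t, |deriv G t| ≤ M) :
    MemH10 Ω (fun y => ζ y * G (u y))
      (fun y => G (u y) • gradient ζ y + (ζ y * deriv G (u y)) • Du y) := by
  obtain ⟨w, hw, hae, hlim, hlimD⟩ := h.exists_seq
  obtain ⟨C, hC⟩ := hζ.compact.exists_bound_of_continuous hζ.smooth.continuous
  obtain ⟨C', hC'⟩ := (hζ.compact.mono' (support_gradient_subset ζ)).exists_bound_of_continuous
    (continuous_gradient hζ.smooth)
  have hM0 : 0 ≤ M := (abs_nonneg _).trans (hM 0)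
  have hdG : Continuous (deriv G) := hG.continuous_deriv (by simp)
  have hum := h.1.memLp.1
  have hDm := h.1.memLp_grad.1
  have hcg := continuous_gradient hζ.smooth
  have hgD : AEStronglyMeasurable (fun y => deriv G (u y) • Du y) (volume.restrict Ω) :=
    (hdG.comp_aestronglyMeasurable hum).smul hDm
  refine memH10_of_tendsto (fun k => hζ.mul_comp (hw k).smooth hG) ?_ ?_ ?_ ?_
  · simpa [mul_comm] using memLp_comp_smul hG hM h.1.memLp (hζ.memLp (volume.restrict Ω) 2) hC
  · refine (memLp_comp_smul hG hM h.1.memLp (hζ.memLp_gradient (volume.restrict Ω) 2) hC').add ?_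
    refine MemLp.of_le_mul (c := C * M) h.1.memLp_grad ?_ (Eventually.of_forall fun y => ?_)
    · exact (hζ.smooth.continuous.aestronglyMeasurable.mul
        (hdG.comp_aestronglyMeasurable hum)).smul hDm
    · rw [norm_smul, norm_mul]
      gcongr
      · exact (norm_nonneg _).trans (hC y)
      · exact hC y
      · exact hM _
  · refine tendsto_eLpNorm_of_norm_le_mul (C := C * M) (fun k y => ?_) hlim
    rw [← mul_sub, norm_mul, mul_assoc]
    gcongr
    · exact (norm_nonneg _).trans (hC y)
    · exact hC y
    · exact abs_sub_le_of_abs_deriv_le hG hM _ _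
  · have h1 : Tendsto (fun k => eLpNorm (fun y => (G (w k y) - G (u y)) • gradient ζ y) 2
        (volume.restrict Ω)) atTop (𝓝 0) := by
      refine tendsto_eLpNorm_of_norm_le_mul (C := C' * M) (fun k y => ?_) hlim
      rw [norm_smul, mul_comm, mul_assoc]
      gcongr
      · exact (norm_nonneg _).trans (hC' y)
      · exact hC' y
      · exact abs_sub_le_of_abs_deriv_le hG hM _ _
    have h2 := tendsto_eLpNorm_comp_smul hdG hM
      (fun k => (hw k).smooth.continuous.aestronglyMeasurable) hum
      (fun k => (continuous_gradient (hw k).smooth).aestronglyMeasurable) h.1.memLp_grad hae hlimD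
    have h3 : Tendsto (fun k => eLpNorm (fun y => ζ y • (deriv G (w k y) • gradient (w k) y -
        deriv G (u y) • Du y)) 2 (volume.restrict Ω)) atTop (𝓝 0) := by
      refine tendsto_eLpNorm_of_norm_le_mul (C := C) (fun k y => ?_) h2
      rw [norm_smul]
      gcongr
      exact hC y
    have h4 := h1.add h3
    rw [add_zero] at h4
    refine tendsto_of_tendsto_of_tendsto_of_le_of_le tendsto_const_nhds h4
      (fun _ => zero_le) fun k => ?_
    refine le_trans (le_of_eq ?_) (eLpNorm_add_le ?_ ?_ one_le_two)
    · congr 1 with y : 1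
      rw [gradient_mul_comp hζ.smooth (hw k).smooth hG]
      simp only [Pi.add_apply]
      module
    · exact ((hG.continuous.comp (hw k).smooth.continuous).aestronglyMeasurable.sub
        (hG.continuous.comp_aestronglyMeasurable hum)).smul hcg.aestronglyMeasurable
    · exact hζ.smooth.continuous.aestronglyMeasurable.smul
        (((hdG.comp (hw k).smooth.continuous).smul
          (continuous_gradient (hw k).smooth)).aestronglyMeasurable.sub hgD)

/-- Apply the smooth inequality to `F ∘ w_k`. The gradients converge in `L²`, and Fatou's lemma in
each variable handles the left side. -/
theorem MemH10.lintegral_lintegral_comp_sub_sq_le {n : ℕ} {Ω : Set (Rn n)} {u : Rn n → ℝ}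
    {Du : Rn n → Rn n} {F : ℝ → ℝ} (h : MemH10 Ω u Du) (hF : ContDiff ℝ ∞ F) {M : ℝ}
    (hM : ∀ t, |deriv F t| ≤ M) {c : Rn n} {r : ℝ} (hB : ball c r ⊆ Ω) :
    ∫⁻ x in ball c r, ∫⁻ y in ball c r, ‖F (u x) - F (u y)‖ₑ ^ 2 ≤
      ENNReal.ofReal (2 * r) ^ 2 * (2 ^ n * volume (ball c r)) *
        ∫⁻ y in ball c r, ‖deriv F (u y) • Du y‖ₑ ^ 2 := by
  obtain ⟨w, hw, hae, -, hlimD⟩ := h.exists_seq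
  have hdF : Continuous (deriv F) := hF.continuous_deriv (by simp)
  have hle : volume.restrict (ball c r) ≤ volume.restrict Ω := Measure.restrict_mono hB le_rfl
  replace hae := ae_mono hle hae
  have hum : AEStronglyMeasurable u (volume.restrict (ball c r)) := h.1.memLp.1.mono_measure hle
  have hD : MemLp Du 2 (volume.restrict (ball c r)) := h.1.memLp_grad.mono_measure hle
  set μ := volume.restrict (ball c r)
  have hlimD' : Tendsto (fun k => eLpNorm (fun y => gradient (w k) y - Du y) 2 μ)
      atTop (𝓝 0) :=
    tendsto_of_tendsto_of_tendsto_of_le_of_le tendsto_const_nhds hlimD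
      (fun _ => zero_le) fun k => eLpNorm_mono_measure _ hle
  have hconv := tendsto_eLpNorm_comp_smul hdF hM
      (fun k => (hw k).smooth.continuous.aestronglyMeasurable) hum
      (fun k => (continuous_gradient (hw k).smooth).aestronglyMeasurable) hD hae hlimD'
  set κ := ENNReal.ofReal (2 * r) ^ 2 * (2 ^ n * volume (ball c r)) with hκ
  have hκt : κ ≠ ⊤ := by
    refine ENNReal.mul_ne_top (ENNReal.pow_ne_top ENNReal.ofReal_ne_top)
      (ENNReal.mul_ne_top (by simp) measure_ball_lt_top.ne)
  have hcF : ∀ k, Continuous fun y => F (w k y) := fun k =>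
    hF.continuous.comp (hw k).smooth.continuous
  have hI : ∀ k, Measurable fun x => ∫⁻ y, ‖F (w k x) - F (w k y)‖ₑ ^ 2 ∂μ := fun k =>
    Measurable.lintegral_prod_right'
      (f := fun p : Rn n × Rn n => ‖F (w k p.1) - F (w k p.2)‖ₑ ^ 2)
      ((ENNReal.continuous_pow 2).comp
        (((hcF k).comp continuous_fst).sub ((hcF k).comp continuous_snd)).enorm).measurable
  have hbound : ∀ k, ∫⁻ x, ∫⁻ y, ‖F (w k x) - F (w k y)‖ₑ ^ 2 ∂μ ∂μ ≤
      κ * (eLpNorm (fun y => deriv F (w k y) • gradient (w k) y - deriv F (u y) • Du y) 2 μ +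
        eLpNorm (fun y => deriv F (u y) • Du y) 2 μ) ^ 2 := by
    intro k
    refine (lintegral_lintegral_sub_sq_le
      ((hF.comp (hw k).smooth).of_le (by simp)) c r).trans ?_
    rw [← hκ]
    gcongr
    have e : ∀ y, ‖fderiv ℝ (F ∘ w k) y‖ₑ = ‖deriv F (w k y) • gradient (w k) y‖ₑ := fun y => by
      rw [← gradient_comp (hw k).smooth hF, ← enorm_gradient]; rfl
    simp_rw [e]
    rw [← eLpNorm_two_sq]
    gcongr
    refine le_trans (le_of_eq ?_) (eLpNorm_add_le ?_ ?_ one_le_two)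
    · congr 1 with y : 1
      simp
    · exact ((hdF.comp (hw k).smooth.continuous).smul
          (continuous_gradient (hw k).smooth)).aestronglyMeasurable.sub
          ((hdF.comp_aestronglyMeasurable hum).smul hD.1)
    · exact (hdF.comp_aestronglyMeasurable hum).smul hD.1
  have hlim2 : Tendsto (fun k => κ * (eLpNorm (fun y => deriv F (w k y) • gradient (w k) y -
      deriv F (u y) • Du y) 2 μ + eLpNorm (fun y => deriv F (u y) • Du y) 2 μ) ^ 2) atTop
      (𝓝 (κ * eLpNorm (fun y => deriv F (u y) • Du y) 2 μ ^ 2)) := by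
    have h1 := hconv.add_const (eLpNorm (fun y => deriv F (u y) • Du y) 2 μ)
    rw [zero_add] at h1
    exact ENNReal.Tendsto.const_mul (((ENNReal.continuous_pow 2).tendsto _).comp h1)
      (Or.inr hκt)
  calc ∫⁻ x, ∫⁻ y, ‖F (u x) - F (u y)‖ₑ ^ 2 ∂μ ∂μ
      ≤ ∫⁻ x, liminf (fun k => ∫⁻ y, ‖F (w k x) - F (w k y)‖ₑ ^ 2 ∂μ) atTop ∂μ := by
        refine lintegral_mono_ae ?_
        filter_upwards [hae] with x hx
        calc ∫⁻ y, ‖F (u x) - F (u y)‖ₑ ^ 2 ∂μ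
            = ∫⁻ y, liminf (fun k => ‖F (w k x) - F (w k y)‖ₑ ^ 2) atTop ∂μ := by
              refine lintegral_congr_ae ?_
              filter_upwards [hae] with y hy
              have h1 := (((hF.continuous.tendsto _).comp hx).sub
                ((hF.continuous.tendsto _).comp hy)).enorm
              exact (((ENNReal.continuous_pow 2).tendsto _).comp h1).liminf_eq.symm
          _ ≤ _ := lintegral_liminf_le fun k =>
            ((ENNReal.continuous_pow 2).comp (continuous_const.sub (hcF k)).enorm).measurable
    _ ≤ liminf (fun k => ∫⁻ x, ∫⁻ y, ‖F (w k x) - F (w k y)‖ₑ ^ 2 ∂μ ∂μ) atTop :=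
        lintegral_liminf_le hI
    _ ≤ κ * eLpNorm (fun y => deriv F (u y) • Du y) 2 μ ^ 2 := by
        rw [← hlim2.liminf_eq]
        exact liminf_le_liminf (Eventually.of_forall hbound)
    _ = _ := by rw [eLpNorm_two_sq]

/-! ### Comparison of the logarithm with `arsinh`, and mean oscillation -/

/-- With `x = t / δ`, the two-sided comparison rests on `1 + x ≤ x + √(1 + x²) ≤ 2 (1 + x)` and `log
2 ≤ 1`. -/
theorem log_add_sub_log_le_arsinh {t δ : ℝ} (ht : 0 ≤ t) (hδ : 0 < δ) :
    Real.log (t + δ) - Real.log δ ≤ Real.arsinh (t / δ) := by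
  rw [← Real.log_div (by positivity) hδ.ne', Real.arsinh]
  apply Real.log_le_log (by positivity)
  rw [add_div, div_self hδ.ne']
  gcongr
  exact Real.le_sqrt_of_sq_le (by nlinarith [sq_nonneg (t / δ)])

theorem arsinh_le_log_add_sub_log {t δ : ℝ} (ht : 0 ≤ t) (hδ : 0 < δ) :
    Real.arsinh (t / δ) ≤ Real.log (t + δ) - Real.log δ + 1 := by
  have hx : 0 ≤ t / δ := by positivity
  have h2 : Real.log 2 ≤ 1 := by linarith [Real.log_two_lt_d9]
  refine le_trans ?_ (add_le_add_right h2 _)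
  rw [← Real.log_div (by positivity) hδ.ne', ← Real.log_mul (by positivity) (by norm_num),
    Real.arsinh]
  apply Real.log_le_log (by positivity)
  rw [add_div, div_self hδ.ne']
  have : √(1 + (t / δ) ^ 2) ≤ 1 + t / δ := Real.sqrt_le_iff.2 ⟨by positivity, by nlinarith⟩
  linarith

theorem abs_log_add_sub_le {s t δ : ℝ} (hs : 0 ≤ s) (ht : 0 ≤ t) (hδ : 0 < δ) :
    |Real.log (s + δ) - Real.log (t + δ)| ≤
      |Real.arsinh (s / δ) - Real.arsinh (t / δ)| + 1 := by
  have h1 := log_add_sub_log_le_arsinh hs hδ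
  have h2 := log_add_sub_log_le_arsinh ht hδ
  have h3 := arsinh_le_log_add_sub_log hs hδ
  have h4 := arsinh_le_log_add_sub_log ht hδ
  have h5 := le_abs_self (Real.arsinh (s / δ) - Real.arsinh (t / δ))
  have h6 := neg_abs_le (Real.arsinh (s / δ) - Real.arsinh (t / δ))
  rw [abs_le]
  constructor <;> linarith

theorem abs_log_add_le {t δ : ℝ} (ht : 0 ≤ t) (hδ : 0 < δ) :
    |Real.log (t + δ)| ≤ |Real.log δ| + δ⁻¹ * |t| := by
  have h1 : Real.log δ ≤ Real.log (t + δ) := Real.log_le_log hδ (by linarith)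
  have h2 : Real.log (t + δ) ≤ Real.log δ + δ⁻¹ * t := by
    have := Real.log_le_sub_one_of_pos (by positivity : 0 < (t + δ) / δ)
    rw [Real.log_div (by positivity) hδ.ne', add_div, div_self hδ.ne', div_eq_inv_mul] at this
    linarith
  have h3 := neg_abs_le (Real.log δ)
  have h4 := le_abs_self (Real.log δ)
  rw [abs_of_nonneg ht]
  have : 0 ≤ δ⁻¹ * t := by positivity
  rw [abs_le]
  constructor <;> linarith

theorem integrableOn_log_add {n : ℕ} {u : Rn n → ℝ} {c : Rn n} {r δ : ℝ}
    (hu : MemLp u 2 (volume.restrict (ball c r)))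
    (hpos : ∀ᵐ y ∂(volume.restrict (ball c r)), 0 ≤ u y) (hδ : 0 < δ) :
    IntegrableOn (fun y => Real.log (u y + δ)) (ball c r) := by
  have : IsFiniteMeasure (volume.restrict (ball c r)) :=
    ⟨by simpa using measure_ball_lt_top⟩
  have h1 : Integrable u (volume.restrict (ball c r)) := hu.integrable one_le_two
  refine Integrable.mono' ((integrable_const |Real.log δ|).add (h1.abs.const_mul δ⁻¹)) ?_ ?_
  · exact (Real.measurable_log.comp_aemeasurable
      (hu.1.aemeasurable.add_const δ)).aestronglyMeasurable
  · filter_upwards [hpos] with y hy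
    exact abs_log_add_le hy hδ

theorem ofReal_rpow_le_one_add_sq {α : ℝ} (hα : 0 ≤ α) (hα2 : α ≤ 2) (t : ℝ) :
    ENNReal.ofReal (|t| ^ α) ≤ 1 + ‖t‖ₑ ^ 2 := by
  have h : |t| ^ α ≤ 1 + |t| ^ 2 := by
    rcases le_total |t| 1 with h1 | h1
    · have := Real.rpow_le_one (abs_nonneg t) h1 hα
      have := sq_nonneg |t|
      linarith
    · have := Real.rpow_le_rpow_of_exponent_le h1 hα2
      rw [Real.rpow_two] at this
      linarith
  refine (ENNReal.ofReal_le_ofReal h).trans ?_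
  rw [ENNReal.ofReal_add zero_le_one (sq_nonneg _), ENNReal.ofReal_one,
    ENNReal.ofReal_pow (abs_nonneg _), Real.enorm_eq_ofReal_abs]

/-- `f x - f_B` is the average of `f x - f y` over `y`, so Cauchy–Schwarz bounds its square by the
averaged squared differences. The summand `1` pays for replacing the exponent `α` by `2`. -/
theorem meanOsc_le_of_lintegral_lintegral {n : ℕ} {α : ℝ} (hα : 0 ≤ α) (hα2 : α ≤ 2)
    {f : Rn n → ℝ} {c : Rn n} {r : ℝ} (hr : 0 < r) (hf : IntegrableOn f (ball c r)) {C : ℝ≥0∞}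
    (h : ∫⁻ x in ball c r, ∫⁻ y in ball c r, ‖f x - f y‖ₑ ^ 2 ≤ C * volume (ball c r) ^ 2) :
    meanOsc α f c r ≤ 1 + C := by
  set B := ball c r
  have hB0 : volume B ≠ 0 := (measure_ball_pos volume c hr).ne'
  have hBt : volume B ≠ ⊤ := measure_ball_lt_top.ne
  have hBr : (volume B).toReal ≠ 0 := ENNReal.toReal_ne_zero.2 ⟨hB0, hBt⟩
  have hpt : ∀ x, ENNReal.ofReal (|f x - ⨍ z in B, f z| ^ α) ≤
      1 + (volume B)⁻¹ * ∫⁻ y in B, ‖f x - f y‖ₑ ^ 2 := by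
    intro x
    refine (ofReal_rpow_le_one_add_sq hα hα2 _).trans ?_
    gcongr
    have e : f x - ⨍ z in B, f z = (volume B).toReal⁻¹ * ∫ z in B, (f x - f z) := by
      have hc : IntegrableOn (fun _ => f x) B := integrableOn_const hBt
      rw [integral_sub hc hf, setIntegral_const, setAverage_eq]
      simp only [smul_eq_mul, Measure.real]
      field_simp
    have e2 : ‖(volume B).toReal⁻¹‖ₑ = (volume B)⁻¹ := by
      rw [Real.enorm_of_nonneg (by positivity), ENNReal.ofReal_inv_of_pos (by positivity),
        ENNReal.ofReal_toReal hBt]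
    have hm : AEMeasurable (fun z => ‖f x - f z‖ₑ) (volume.restrict B) :=
      (aestronglyMeasurable_const.sub hf.1).enorm
    calc ‖f x - ⨍ z in B, f z‖ₑ ^ 2
        ≤ ((volume B)⁻¹ * ∫⁻ z in B, ‖f x - f z‖ₑ) ^ 2 := by
          rw [e, enorm_mul, e2]
          gcongr
          exact enorm_integral_le_lintegral_enorm _
      _ ≤ (volume B)⁻¹ ^ 2 * (volume B * ∫⁻ z in B, ‖f x - f z‖ₑ ^ 2) := by
          rw [mul_pow]
          gcongr
          simpa using sq_lintegral_le (volume.restrict B) hm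
      _ = (volume B)⁻¹ * ∫⁻ z in B, ‖f x - f z‖ₑ ^ 2 := by
          rw [sq, mul_assoc, ← mul_assoc (volume B)⁻¹ (volume B),
            ENNReal.inv_mul_cancel hB0 hBt, one_mul]
  rw [meanOsc, setLAverage_eq]
  calc (∫⁻ y in B, ENNReal.ofReal (|f y - ⨍ z in B, f z| ^ α)) / volume B
      ≤ (∫⁻ x in B, (1 + (volume B)⁻¹ * ∫⁻ y in B, ‖f x - f y‖ₑ ^ 2)) / volume B := by
        gcongr with x
        exact hpt x
    _ ≤ (volume B + (volume B)⁻¹ * (C * volume B ^ 2)) / volume B := by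
        gcongr
        rw [lintegral_add_left measurable_const, lintegral_const_mul' _ _ (by simpa using hB0)]
        simp only [lintegral_const, one_mul, Measure.restrict_apply_univ]
        gcongr
    _ = 1 + C := by
        rw [ENNReal.add_div, ENNReal.div_self hB0 hBt, sq, mul_left_comm, ← mul_assoc (volume B)⁻¹,
          ENNReal.inv_mul_cancel hB0 hBt, one_mul, ENNReal.mul_div_cancel_right hB0 hBt]

/-! ### The energy estimate -/

theorem contDiff_sqrt_add_sq {δ : ℝ} (hδ : 0 < δ) :
    ContDiff ℝ ∞ fun t : ℝ => √(δ ^ 2 + t ^ 2) :=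
  ContDiff.sqrt (by fun_prop) fun t => by positivity

theorem contDiff_sqrt_add_sq_sub {δ : ℝ} (hδ : 0 < δ) :
    ContDiff ℝ ∞ fun t : ℝ => √(δ ^ 2 + t ^ 2) - t :=
  (contDiff_sqrt_add_sq hδ).sub contDiff_id

theorem deriv_sqrt_add_sq_sub {δ : ℝ} (hδ : 0 < δ) (t : ℝ) :
    deriv (fun t : ℝ => √(δ ^ 2 + t ^ 2) - t) t = t / √(δ ^ 2 + t ^ 2) - 1 := by
  have h1 : HasDerivAt (fun t : ℝ => δ ^ 2 + t ^ 2) (2 * t) t := by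
    simpa using ((hasDerivAt_id t).pow 2).const_add (δ ^ 2)
  have h2 := ((h1.sqrt (by positivity)).sub (hasDerivAt_id t)).deriv
  refine Eq.trans h2 ?_
  rw [mul_div_mul_left _ _ two_ne_zero]

theorem abs_le_sqrt_add_sq (δ t : ℝ) : |t| ≤ √(δ ^ 2 + t ^ 2) :=
  Real.abs_le_sqrt (by nlinarith [sq_nonneg δ])

theorem abs_deriv_sqrt_add_sq_sub_le {δ : ℝ} (hδ : 0 < δ) (t : ℝ) :
    |deriv (fun t : ℝ => √(δ ^ 2 + t ^ 2) - t) t| ≤ 2 := by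
  rw [deriv_sqrt_add_sq_sub hδ]
  have hs : 0 < √(δ ^ 2 + t ^ 2) := Real.sqrt_pos.2 (by positivity)
  have h1 : |t / √(δ ^ 2 + t ^ 2)| ≤ 1 := by
    rw [abs_div, abs_of_pos hs, div_le_one hs]
    exact abs_le_sqrt_add_sq δ t
  rw [abs_le] at h1 ⊢
  constructor <;> linarith

theorem deriv_arsinh_div {δ : ℝ} (hδ : 0 < δ) (t : ℝ) :
    deriv (fun t : ℝ => Real.arsinh (t / δ)) t = (√(δ ^ 2 + t ^ 2))⁻¹ := by
  have h1 : HasDerivAt (fun t : ℝ => t / δ) (1 / δ) t := (hasDerivAt_id t).div_const δ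
  have h2 := h1.arsinh.deriv
  rw [h2]
  have e : √(δ ^ 2 + t ^ 2) = δ * √(1 + (t / δ) ^ 2) := by
    rw [← Real.sqrt_sq hδ.le, ← Real.sqrt_mul (sq_nonneg δ), Real.sqrt_sq hδ.le]
    congr 1
    field_simp
  rw [e, mul_inv, smul_eq_mul, one_div, mul_comm]

theorem abs_deriv_arsinh_div_le {δ : ℝ} (hδ : 0 < δ) (t : ℝ) :
    |deriv (fun t : ℝ => Real.arsinh (t / δ)) t| ≤ δ⁻¹ := by
  rw [deriv_arsinh_div hδ, abs_of_nonneg (by positivity)]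
  gcongr
  exact Real.le_sqrt_of_sq_le (by nlinarith [sq_nonneg t])

theorem IsTestFunction.sq {n : ℕ} {Ω : Set (Rn n)} {η : Rn n → ℝ} (hη : IsTestFunction Ω η) :
    IsTestFunction Ω (fun y => η y ^ 2) where
  smooth := hη.smooth.pow 2
  compact := by
    have e : (fun y => η y ^ 2) = η * η := by ext y; simp [pow_two]
    rw [e]
    exact hη.compact.mul_left
  support := by
    have := (tsupport_mul_subset_left (f := η) (g := η)).trans hη.support
    simpa only [Pi.mul_def, ← pow_two] using this

theorem gradient_sq {n : ℕ} {η : Rn n → ℝ} (hη : ContDiff ℝ ∞ η) (y : Rn n) :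
    gradient (fun y => η y ^ 2) y = (2 * η y) • gradient η y := by
  rw [gradient_comp (F := fun t => t ^ 2) hη (by fun_prop)]
  simp

/-- The Caccioppoli-type estimate for `Du / √(δ² + u²)`. -/
theorem integral_energy_le {n : ℕ} {Ω : Set (Rn n)} {lam : ℝ} (hlam : 0 < lam)
    {a : Fin n → Fin n → Rn n → ℝ} {b : Fin n → Rn n → ℝ} {V : Rn n → ℝ} {u : Rn n → ℝ}
    {Du : Rn n → Rn n} (ha : IsElliptic Ω lam a)
    (hb : ∀ i, MemLp (b i) 2 (volume.restrict Ω)) (hV : Integrable V (volume.restrict Ω))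
    (hu : MemH10 Ω u Du)
    (hsol : ∀ (ψ : Rn n → ℝ) (Dψ : Rn n → Rn n), MemH10 Ω ψ Dψ →
      ∫ y in Ω, ((∑ i, ∑ j, a i j y * Du y i * Dψ y j) + (∑ i, b i y * Du y i * ψ y)
        + V y * u y * ψ y) = 0)
    (hpos : ∀ᵐ y ∂(volume.restrict Ω), 0 ≤ u y) {η : Rn n → ℝ} (hη : IsTestFunction Ω η)
    {δ : ℝ} (hδ : 0 < δ) :
    Integrable (fun y => (η y / √(δ ^ 2 + u y ^ 2) * ‖Du y‖) ^ 2) (volume.restrict Ω) ∧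
    Integrable (fun y => 2 * lam⁻¹ * ‖gradient η y‖ ^ 2 + lam⁻¹ * (η y ^ 2 * ∑ i, b i y ^ 2)
      + η y ^ 2 * |V y|) (volume.restrict Ω) ∧
    lam / 8 * ∫ y in Ω, (η y / √(δ ^ 2 + u y ^ 2) * ‖Du y‖) ^ 2 ≤
      ∫ y in Ω, (2 * lam⁻¹ * ‖gradient η y‖ ^ 2 + lam⁻¹ * (η y ^ 2 * ∑ i, b i y ^ 2)
      + η y ^ 2 * |V y|) := by
  set μ := volume.restrict Ω
  obtain ⟨C, hC⟩ := hη.compact.exists_bound_of_continuous hη.smooth.continuous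
  have hψ := hu.testFunction_mul_comp hη.sq (contDiff_sqrt_add_sq_sub hδ)
    (abs_deriv_sqrt_add_sq_sub_le hδ)
  have hcs : Continuous fun t : ℝ => √(δ ^ 2 + t ^ 2) := (contDiff_sqrt_add_sq hδ).continuous
  have hs0 : ∀ t, 0 < √(δ ^ 2 + t ^ 2) := fun t => Real.sqrt_pos.2 (by positivity)
  have hum := hu.1.memLp.1
  have hZ : Integrable (fun y => (η y / √(δ ^ 2 + u y ^ 2) * ‖Du y‖) ^ 2) μ := by
    refine MemLp.integrable_sq (MemLp.of_le_mul (c := C * δ⁻¹) hu.1.memLp_grad ?_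
      (Eventually.of_forall fun y => ?_))
    · exact ((hη.smooth.continuous.aestronglyMeasurable).div₀
        (hcs.comp_aestronglyMeasurable hum)).mul hu.1.memLp_grad.1.norm
    · rw [norm_mul, norm_norm, norm_div, div_eq_mul_inv]
      gcongr
      · exact (norm_nonneg _).trans (hC y)
      · exact hC y
      · rw [Real.norm_of_nonneg (hs0 _).le]
        exact Real.le_sqrt_of_sq_le (by nlinarith [sq_nonneg (u y)])
  have hC2 : ∀ y, ‖η y ^ 2‖ ≤ C ^ 2 := fun y => by
    rw [norm_pow]; gcongr; exact hC y
  have hP : Integrable (fun y => 2 * lam⁻¹ * ‖gradient η y‖ ^ 2 +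
      lam⁻¹ * (η y ^ 2 * ∑ i, b i y ^ 2) + η y ^ 2 * |V y|) μ := by
    refine ((((hη.memLp_gradient μ 2).norm.integrable_sq).const_mul _).add
      (Integrable.const_mul ?_ _)).add ?_
    · exact (integrable_finsetSum _ fun i _ => (hb i).integrable_sq).bdd_mul
        (hη.smooth.continuous.pow 2).aestronglyMeasurable (Eventually.of_forall hC2)
    · exact hV.abs.bdd_mul
        (hη.smooth.continuous.pow 2).aestronglyMeasurable (Eventually.of_forall hC2)
  refine ⟨hZ, hP, ?_⟩
  have h0 := hsol _ _ hψ
  -- For `u ≥ 0`, `s - u ≤ δ` and `u (s - u) ≤ δ²`. Boundedness of `ψ` and `u ψ` makes the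
  -- lower-order terms integrable from `b ∈ L²` and `V ∈ L¹` alone.
  have hψ2 : ∀ᵐ y ∂μ, ‖η y ^ 2 * (√(δ ^ 2 + u y ^ 2) - u y)‖ ≤ C ^ 2 * δ := by
    filter_upwards [hpos] with y hy
    rw [norm_mul]
    gcongr
    · exact hC2 y
    · have h1 := le_trans (le_abs_self _) (abs_le_sqrt_add_sq δ (u y))
      rw [Real.norm_of_nonneg (by linarith)]
      have : √(δ ^ 2 + u y ^ 2) ≤ δ + u y := Real.sqrt_le_iff.2 ⟨by positivity, by nlinarith⟩
      linarith
  have hψ3 : ∀ᵐ y ∂μ, ‖u y * (η y ^ 2 * (√(δ ^ 2 + u y ^ 2) - u y))‖ ≤ C ^ 2 * δ ^ 2 := by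
    filter_upwards [hpos] with y hy
    have h1 := le_trans (le_abs_self _) (abs_le_sqrt_add_sq δ (u y))
    have h2 : √(δ ^ 2 + u y ^ 2) ^ 2 = δ ^ 2 + u y ^ 2 := Real.sq_sqrt (by positivity)
    rw [mul_left_comm, norm_mul]
    gcongr
    · exact hC2 y
    · rw [Real.norm_of_nonneg (mul_nonneg hy (by linarith))]
      nlinarith
  have hI : Integrable (fun y => (∑ i, ∑ j, a i j y * Du y i *
      ((√(δ ^ 2 + u y ^ 2) - u y) • gradient (fun y => η y ^ 2) y +
        (η y ^ 2 * deriv (fun t : ℝ => √(δ ^ 2 + t ^ 2) - t) (u y)) • Du y) j)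
      + (∑ i, b i y * Du y i * (η y ^ 2 * (√(δ ^ 2 + u y ^ 2) - u y)))
      + V y * u y * (η y ^ 2 * (√(δ ^ 2 + u y ^ 2) - u y))) μ := by
    refine ((integrable_finsetSum _ fun i _ => integrable_finsetSum _ fun j _ => ?_).add
      (integrable_finsetSum _ fun i _ => ?_)).add ?_
    · have h1 : MemLp (fun y => a i j y * Du y i) 2 μ :=
        (memLp_component hu.1.memLp_grad i).mul (ha.memLp i j)
      exact h1.integrable_mul (memLp_component hψ.1.memLp_grad j)
    · exact ((hb i).integrable_mul (memLp_component hu.1.memLp_grad i)).mul_bdd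
        hψ.1.memLp.1 hψ2
    · have := hV.mul_bdd (hum.mul hψ.1.memLp.1) hψ3
      simpa only [mul_assoc, Pi.mul_apply] using this
  have hle : ∫ y in Ω, ((∑ i, ∑ j, a i j y * Du y i *
      ((√(δ ^ 2 + u y ^ 2) - u y) • gradient (fun y => η y ^ 2) y +
        (η y ^ 2 * deriv (fun t : ℝ => √(δ ^ 2 + t ^ 2) - t) (u y)) • Du y) j)
      + (∑ i, b i y * Du y i * (η y ^ 2 * (√(δ ^ 2 + u y ^ 2) - u y)))
      + V y * u y * (η y ^ 2 * (√(δ ^ 2 + u y ^ 2) - u y))) ≤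
      ∫ y in Ω, δ ^ 2 * (-(lam / 8) * (η y / √(δ ^ 2 + u y ^ 2) * ‖Du y‖) ^ 2 +
        (2 * lam⁻¹ * ‖gradient η y‖ ^ 2 + lam⁻¹ * (η y ^ 2 * ∑ i, b i y ^ 2)
          + η y ^ 2 * |V y|)) := by
    refine integral_mono_ae hI (((hZ.const_mul _).add hP).const_mul _) ?_
    filter_upwards [hpos, ha.symm, ha.lower, ha.upper] with y hy h1 h2 h3
    have := energy_integrand_le hlam h1 h2 h3 (fun i => b i y) (V y) (η y) (Du y)
      (gradient η y) hy hδ rfl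
    simpa only [gradient_sq hη.smooth, deriv_sqrt_add_sq_sub hδ] using this
  -- The tested equation makes the left side `0`, so the positive factor `δ²` drops out and the
  -- estimate does not depend on `δ`.
  rw [h0, integral_const_mul, integral_add (hZ.const_mul _) hP, integral_const_mul] at hle
  have := nonneg_of_mul_nonneg_right hle (by positivity : 0 < δ ^ 2)
  linarith

/-! ### Cutoffs and the gradient bound at scale `r` -/

theorem exists_cutoff (n : ℕ) : ∃ L : ℝ, 0 ≤ L ∧ ∀ (x : Rn n) (r : ℝ), 0 < r →
    ∃ η : Rn n → ℝ, IsTestFunction (ball x (2 * r)) η ∧ (∀ y ∈ ball x r, η y = 1) ∧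
      (∀ y, |η y| ≤ 1) ∧ ∀ y, ‖gradient η y‖ ≤ L / r := by
  -- One fixed bump is rescaled, so `L` depends on `n` only; the outer radius `3/2 < 2` puts the
  -- closed support inside the open ball of radius `2r`.
  let f : ContDiffBump (0 : Rn n) := ⟨1, 3 / 2, one_pos, by norm_num⟩
  have hfs : ContDiff ℝ ∞ f := f.contDiff
  obtain ⟨L, hL⟩ := (f.hasCompactSupport.mono' (support_gradient_subset f)).exists_bound_of_continuous
    (continuous_gradient hfs)
  refine ⟨L, (norm_nonneg _).trans (hL 0), fun x r hr => ?_⟩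
  have hη : ContDiff ℝ ∞ fun y => f (r⁻¹ • (y - x)) := hfs.comp (by fun_prop)
  have hts : tsupport (fun y => f (r⁻¹ • (y - x))) ⊆ closedBall x (3 / 2 * r) := by
    refine closure_minimal (fun y hy => ?_) isClosed_closedBall
    have h1 : r⁻¹ • (y - x) ∈ ball (0 : Rn n) (3 / 2) := by
      have : r⁻¹ • (y - x) ∈ Function.support f := hy
      rwa [f.support_eq] at this
    rw [mem_ball_zero_iff, norm_smul, norm_inv, Real.norm_of_nonneg hr.le,
      inv_mul_lt_iff₀ hr] at h1
    rw [mem_closedBall, dist_eq_norm]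
    linarith
  refine ⟨fun y => f (r⁻¹ • (y - x)), ⟨hη, ?_, ?_⟩, fun y hy => ?_, fun y => ?_, fun y => ?_⟩
  · exact HasCompactSupport.of_support_subset_isCompact (isCompact_closedBall x (3 / 2 * r))
      (subset_closure.trans hts)
  · exact hts.trans (closedBall_subset_ball (by linarith))
  · apply f.one_of_mem_closedBall
    rw [mem_ball, dist_eq_norm] at hy
    rw [mem_closedBall_zero_iff, norm_smul, norm_inv, Real.norm_of_nonneg hr.le,
      inv_mul_le_iff₀ hr]
    change ‖y - x‖ ≤ r * 1
    linarith
  · rw [abs_of_nonneg f.nonneg]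
    exact f.le_one
  · have h1 : HasFDerivAt (fun y : Rn n => r⁻¹ • (y - x))
        (r⁻¹ • ContinuousLinearMap.id ℝ (Rn n)) y :=
      ((hasFDerivAt_id y).sub_const x).const_smul r⁻¹
    have h2 := ((hfs.differentiable (by simp) (r⁻¹ • (y - x))).hasFDerivAt.comp y h1).fderiv
    rw [norm_gradient]
    simp only [Function.comp_def] at h2
    rw [h2]
    simp only [ContinuousLinearMap.comp_smul, ContinuousLinearMap.comp_id]
    rw [norm_smul, ← norm_gradient, norm_inv, Real.norm_of_nonneg hr.le, div_eq_inv_mul]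
    gcongr
    exact hL _

theorem lintegral_energy_le {n : ℕ} {Ω : Set (Rn n)} {lam : ℝ} (hlam : 0 < lam)
    {a : Fin n → Fin n → Rn n → ℝ} {b : Fin n → Rn n → ℝ} {V : Rn n → ℝ} {u : Rn n → ℝ}
    {Du : Rn n → Rn n} (hΩ : MeasurableSet Ω) (ha : IsElliptic Ω lam a)
    (hb : ∀ i, MemLp (b i) 2 (volume.restrict Ω)) (hV : Integrable V (volume.restrict Ω))
    (hu : MemH10 Ω u Du)
    (hsol : ∀ (ψ : Rn n → ℝ) (Dψ : Rn n → Rn n), MemH10 Ω ψ Dψ →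
      ∫ y in Ω, ((∑ i, ∑ j, a i j y * Du y i * Dψ y j) + (∑ i, b i y * Du y i * ψ y)
        + V y * u y * ψ y) = 0)
    (hpos : ∀ᵐ y ∂(volume.restrict Ω), 0 ≤ u y) {η : Rn n → ℝ} {x : Rn n} {r : ℝ} (hr : 0 < r)
    (hB : ball x (2 * r) ⊆ Ω) (hη : IsTestFunction (ball x (2 * r)) η)
    (hη1 : ∀ y ∈ ball x r, η y = 1) (hηle : ∀ y, |η y| ≤ 1) {L : ℝ}
    (hL : ∀ y, ‖gradient η y‖ ≤ L) {δ : ℝ} (hδ : 0 < δ) :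
    ENNReal.ofReal (lam / 8) *
      ∫⁻ y in ball x r, ‖(√(δ ^ 2 + u y ^ 2))⁻¹ • Du y‖ₑ ^ 2 ≤
      ENNReal.ofReal (2 * lam⁻¹ * L ^ 2) * volume (ball x (2 * r)) +
      (∑ i, ENNReal.ofReal lam⁻¹ * ∫⁻ y in ball x (2 * r), ‖b i y‖ₑ ^ 2) +
      ∫⁻ y in ball x (2 * r), ‖V y‖ₑ := by
  have hηΩ : IsTestFunction Ω η := ⟨hη.smooth, hη.compact, hη.support.trans hB⟩
  obtain ⟨hZ, hP, hle⟩ := integral_energy_le hlam ha hb hV hu hsol hpos hηΩ hδ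
  have hBr : ball x r ⊆ ball x (2 * r) := ball_subset_ball (by linarith)
  set P : Rn n → ℝ := fun y => 2 * lam⁻¹ * ‖gradient η y‖ ^ 2 +
    lam⁻¹ * (η y ^ 2 * ∑ i, b i y ^ 2) + η y ^ 2 * |V y| with hPdef
  have hP0 : ∀ y, 0 ≤ P y := fun y => by positivity
  have h1 : ∫⁻ y in ball x r, ‖(√(δ ^ 2 + u y ^ 2))⁻¹ • Du y‖ₑ ^ 2 ≤
      ENNReal.ofReal (∫ y in Ω, (η y / √(δ ^ 2 + u y ^ 2) * ‖Du y‖) ^ 2) := by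
    rw [ofReal_integral_eq_lintegral_ofReal hZ (Eventually.of_forall fun y => sq_nonneg _)]
    refine le_trans ?_ (lintegral_mono_set (hBr.trans hB))
    refine setLIntegral_mono' measurableSet_ball fun y hy => ?_
    rw [hη1 y hy, ← ofReal_norm, ← ENNReal.ofReal_pow (norm_nonneg _), norm_smul, one_div,
      Real.norm_of_nonneg (by positivity)]
  have h2 : ENNReal.ofReal (∫ y in Ω, P y) ≤ ∫⁻ y in ball x (2 * r),
      (ENNReal.ofReal (2 * lam⁻¹ * L ^ 2) + (∑ i, ENNReal.ofReal lam⁻¹ * ‖b i y‖ₑ ^ 2) +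
        ‖V y‖ₑ) := by
    rw [ofReal_integral_eq_lintegral_ofReal hP (Eventually.of_forall hP0),
      ← lintegral_indicator hΩ, ← lintegral_indicator measurableSet_ball]
    refine lintegral_mono fun y => ?_
    by_cases hy : y ∈ ball x (2 * r)
    · rw [indicator_of_mem hy, indicator_of_mem (hB hy)]
      have hη2 : η y ^ 2 ≤ 1 := by
        rw [← sq_abs]; exact pow_le_one₀ (abs_nonneg _) (hηle y)
      have hS : 0 ≤ ∑ i, b i y ^ 2 := Finset.sum_nonneg fun i _ => sq_nonneg _
      have hle : P y ≤ 2 * lam⁻¹ * L ^ 2 + lam⁻¹ * ∑ i, b i y ^ 2 + |V y| := by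
        simp only [hPdef]
        have t1 : ‖gradient η y‖ ^ 2 ≤ L ^ 2 := by gcongr; exact hL y
        have t2 : η y ^ 2 * ∑ i, b i y ^ 2 ≤ ∑ i, b i y ^ 2 := mul_le_of_le_one_left hS hη2
        have t3 : η y ^ 2 * |V y| ≤ |V y| := mul_le_of_le_one_left (abs_nonneg _) hη2
        gcongr
      refine (ENNReal.ofReal_le_ofReal hle).trans (le_of_eq ?_)
      rw [ENNReal.ofReal_add (by positivity) (abs_nonneg _),
        ENNReal.ofReal_add (by positivity) (by positivity),
        ENNReal.ofReal_mul (p := lam⁻¹) (by positivity),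
        ENNReal.ofReal_sum_of_nonneg fun i _ => sq_nonneg _, Finset.mul_sum,
        Real.enorm_eq_ofReal_abs]
      congr 2
      refine Finset.sum_congr rfl fun i _ => ?_
      rw [Real.enorm_eq_ofReal_abs, ← ENNReal.ofReal_pow (abs_nonneg _), sq_abs]
    · have hyt : y ∉ tsupport η := fun h => hy (hη.support h)
      have e1 : η y = 0 := image_eq_zero_of_notMem_tsupport hyt
      have e2 : gradient η y = 0 := by
        by_contra h
        exact hyt (support_gradient_subset η h)
      have : P y = 0 := by simp [hPdef, e1, e2]
      by_cases hyΩ : y ∈ Ω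
      · rw [indicator_of_mem hyΩ, this]; simp
      · rw [indicator_of_notMem hyΩ]; simp
  have hbm : ∀ i, AEMeasurable (fun y => ENNReal.ofReal lam⁻¹ * ‖b i y‖ₑ ^ 2)
      (volume.restrict (ball x (2 * r))) := fun i =>
    (((hb i).1.mono_measure (Measure.restrict_mono hB le_rfl)).enorm.pow_const 2).const_mul _
  calc _ ≤ ENNReal.ofReal (lam / 8) *
        ENNReal.ofReal (∫ y in Ω, (η y / √(δ ^ 2 + u y ^ 2) * ‖Du y‖) ^ 2) := by gcongr
    _ = ENNReal.ofReal (lam / 8 * ∫ y in Ω, (η y / √(δ ^ 2 + u y ^ 2) * ‖Du y‖) ^ 2) := by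
        rw [ENNReal.ofReal_mul (by positivity)]
    _ ≤ ENNReal.ofReal (∫ y in Ω, P y) := ENNReal.ofReal_le_ofReal hle
    _ ≤ _ := h2
    _ = _ := by
        have hm : AEMeasurable (fun y => ENNReal.ofReal (2 * lam⁻¹ * L ^ 2) +
            ∑ i, ENNReal.ofReal lam⁻¹ * ‖b i y‖ₑ ^ 2) (volume.restrict (ball x (2 * r))) :=
          aemeasurable_const.add (Finset.aemeasurable_fun_sum _ fun i _ => hbm i)
        rw [lintegral_add_left' hm,
          lintegral_add_left measurable_const, lintegral_const,
          lintegral_finsetSum' _ fun i _ => hbm i]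
        simp_rw [lintegral_const_mul' _ _ ENNReal.ofReal_ne_top]
        simp

theorem volume_ball_eq {n : ℕ} (x : Rn n) {r : ℝ} (hr : 0 < r) :
    volume (ball x r) = ENNReal.ofReal (r ^ n * (volume (ball (0 : Rn n) 1)).toReal) := by
  have h := Measure.addHaar_ball_of_pos (volume : Measure (Rn n)) x hr
  rw [finrank_euclideanSpace, Fintype.card_fin] at h
  rw [h, ENNReal.ofReal_mul (by positivity), ENNReal.ofReal_toReal measure_ball_lt_top.ne]

theorem volume_unit_ball_pos (n : ℕ) : 0 < (volume (ball (0 : Rn n) 1)).toReal :=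
  ENNReal.toReal_pos (measure_ball_pos volume 0 one_pos).ne' measure_ball_lt_top.ne

theorem exists_lintegral_grad_le {n : ℕ} (hn : 2 ≤ n) {lam M : ℝ} (hlam : 0 < lam)
    (hM : 0 ≤ M) : ∃ C : ℝ, 0 ≤ C ∧
    ∀ (Ω : Set (Rn n)) (a : Fin n → Fin n → Rn n → ℝ) (b : Fin n → Rn n → ℝ) (V : Rn n → ℝ)
      (u : Rn n → ℝ) (Du : Rn n → Rn n), IsOpen Ω → IsElliptic Ω lam a →
    (∀ i, MemLp (b i) 2 (volume.restrict Ω)) → Integrable V (volume.restrict Ω) →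
    (∀ i (x : Rn n) (r : ℝ), 0 < r → r ≤ 1 →
      ∫⁻ y in ball x (2 * r), ‖b i y‖ₑ ^ 2 ≤ ENNReal.ofReal (M * r ^ (n - 2))) →
    (∀ (x : Rn n) (r : ℝ), 0 < r → r ≤ 1 →
      ∫⁻ y in ball x (2 * r), ‖V y‖ₑ ≤ ENNReal.ofReal (M * r ^ (n - 2))) →
    MemH10 Ω u Du →
    (∀ (ψ : Rn n → ℝ) (Dψ : Rn n → Rn n), MemH10 Ω ψ Dψ →
      ∫ y in Ω, ((∑ i, ∑ j, a i j y * Du y i * Dψ y j) + (∑ i, b i y * Du y i * ψ y)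
        + V y * u y * ψ y) = 0) →
    (∀ᵐ y ∂(volume.restrict Ω), 0 ≤ u y) → ∀ (x : Rn n) (r : ℝ), 0 < r → r ≤ 1 →
    ball x (2 * r) ⊆ Ω → ∀ δ : ℝ, 0 < δ →
    ∫⁻ y in ball x r, ‖(√(δ ^ 2 + u y ^ 2))⁻¹ • Du y‖ₑ ^ 2 ≤
      ENNReal.ofReal (C * r ^ (n - 2)) := by
  obtain ⟨L, hL0, hL⟩ := exists_cutoff n
  set v := (volume (ball (0 : Rn n) 1)).toReal
  have hv : 0 < v := volume_unit_ball_pos n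
  -- The three summands come from the cutoff gradient on a ball of volume `(2r)ⁿ v`, the `n` drift
  -- components, and `V`; the factor `8 / lam` below undoes `λ/8`.
  set c := 2 * lam⁻¹ * L ^ 2 * (2 ^ n * v) + n * (lam⁻¹ * M) + M with hc
  have hc0 : 0 ≤ c := by positivity
  refine ⟨8 / lam * c, by positivity, ?_⟩
  intro Ω a b V u Du hΩ ha hb hV hbM hVM hu hsol hpos x r hr hr1 hB δ hδ
  obtain ⟨η, hη, hη1, hηle, hηL⟩ := hL x r hr
  have h := lintegral_energy_le hlam hΩ.measurableSet ha hb hV hu hsol hpos hr hB hη hη1 hηle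
    hηL hδ
  have h2 : ENNReal.ofReal (lam / 8) *
      ∫⁻ y in ball x r, ‖(√(δ ^ 2 + u y ^ 2))⁻¹ • Du y‖ₑ ^ 2 ≤
      ENNReal.ofReal (c * r ^ (n - 2)) := by
    refine h.trans ?_
    calc _ ≤ ENNReal.ofReal (2 * lam⁻¹ * (L / r) ^ 2) * ENNReal.ofReal ((2 * r) ^ n * v) +
          (∑ _i : Fin n, ENNReal.ofReal lam⁻¹ * ENNReal.ofReal (M * r ^ (n - 2))) +
          ENNReal.ofReal (M * r ^ (n - 2)) := by
          rw [volume_ball_eq x (by positivity : 0 < 2 * r)]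
          gcongr with i
          · exact hbM i x r hr hr1
          · exact hVM x r hr hr1
      _ = ENNReal.ofReal (c * r ^ (n - 2)) := by
          rw [Finset.sum_const, Finset.card_univ, Fintype.card_fin, nsmul_eq_mul,
            ← ENNReal.ofReal_natCast, ← ENNReal.ofReal_mul (by positivity),
            ← ENNReal.ofReal_mul (by positivity), ← ENNReal.ofReal_mul (by positivity),
            ← ENNReal.ofReal_add (by positivity) (by positivity),
            ← ENNReal.ofReal_add (by positivity) (by positivity)]
          congr 1
          have e : r ^ n = r ^ (n - 2) * r ^ 2 := by rw [← pow_add]; congr 1; omega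
          rw [hc, mul_pow, e]
          field_simp
  calc ∫⁻ y in ball x r, ‖(√(δ ^ 2 + u y ^ 2))⁻¹ • Du y‖ₑ ^ 2
      = ENNReal.ofReal (8 / lam) * (ENNReal.ofReal (lam / 8) *
        ∫⁻ y in ball x r, ‖(√(δ ^ 2 + u y ^ 2))⁻¹ • Du y‖ₑ ^ 2) := by
        rw [← mul_assoc, ← ENNReal.ofReal_mul (by positivity)]
        have : 8 / lam * (lam / 8) = 1 := by field_simp
        rw [this, ENNReal.ofReal_one, one_mul]
    _ ≤ ENNReal.ofReal (8 / lam) * ENNReal.ofReal (c * r ^ (n - 2)) := by gcongr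
    _ = _ := by
        rw [← ENNReal.ofReal_mul (by positivity), mul_assoc]

/-! ### Oscillation of the logarithm -/

theorem enorm_log_sub_sq_le {s t δ : ℝ} (hs : 0 ≤ s) (ht : 0 ≤ t) (hδ : 0 < δ) :
    ‖Real.log (s + δ) - Real.log (t + δ)‖ₑ ^ 2 ≤
      2 * ‖Real.arsinh (s / δ) - Real.arsinh (t / δ)‖ₑ ^ 2 + 2 := by
  have h := abs_log_add_sub_le hs ht hδ
  set A := Real.log (s + δ) - Real.log (t + δ)
  set B := Real.arsinh (s / δ) - Real.arsinh (t / δ)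
  have h2 : |A| ^ 2 ≤ 2 * |B| ^ 2 + 2 := by
    have : |A| ^ 2 ≤ (|B| + 1) ^ 2 := by gcongr
    nlinarith [sq_nonneg (|B| - 1)]
  rw [Real.enorm_eq_ofReal_abs, Real.enorm_eq_ofReal_abs, ← ENNReal.ofReal_pow (abs_nonneg _),
    ← ENNReal.ofReal_pow (abs_nonneg _)]
  refine (ENNReal.ofReal_le_ofReal h2).trans (le_of_eq ?_)
  rw [ENNReal.ofReal_add (by positivity) (by positivity), ENNReal.ofReal_mul (by positivity)]
  simp

theorem lintegral_lintegral_log_sub_sq_le {n : ℕ} (hn : 2 ≤ n) {Ω : Set (Rn n)} {u : Rn n → ℝ}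
    {Du : Rn n → Rn n} (hu : MemH10 Ω u Du) (hpos : ∀ᵐ y ∂(volume.restrict Ω), 0 ≤ u y)
    {x : Rn n} {r δ C : ℝ} (hr : 0 < r) (hB : ball x r ⊆ Ω) (hδ : 0 < δ) (hC : 0 ≤ C)
    (h : ∫⁻ y in ball x r, ‖(√(δ ^ 2 + u y ^ 2))⁻¹ • Du y‖ₑ ^ 2 ≤
      ENNReal.ofReal (C * r ^ (n - 2))) :
    ∫⁻ y in ball x r, ∫⁻ z in ball x r, ‖Real.log (u y + δ) - Real.log (u z + δ)‖ₑ ^ 2 ≤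
      ENNReal.ofReal (8 * 2 ^ n * C / (volume (ball (0 : Rn n) 1)).toReal + 2) *
        volume (ball x r) ^ 2 := by
  set v := (volume (ball (0 : Rn n) 1)).toReal
  have hv : 0 < v := volume_unit_ball_pos n
  have hF : ContDiff ℝ ∞ fun t : ℝ => Real.arsinh (t / δ) :=
    (contDiff_id.div_const δ).arsinh
  have h1 := hu.lintegral_lintegral_comp_sub_sq_le hF (abs_deriv_arsinh_div_le hδ) hB
  simp_rw [deriv_arsinh_div hδ] at h1
  have hpos' := ae_mono (Measure.restrict_mono hB le_rfl) hpos
  set W := volume (ball x r) with hW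
  have h2 : ∫⁻ y in ball x r, ∫⁻ z in ball x r,
      ‖Real.arsinh (u y / δ) - Real.arsinh (u z / δ)‖ₑ ^ 2 ≤
      ENNReal.ofReal (4 * 2 ^ n * C / v) * W ^ 2 := by
    refine h1.trans ?_
    calc _ ≤ ENNReal.ofReal (2 * r) ^ 2 * (2 ^ n * W) * ENNReal.ofReal (C * r ^ (n - 2)) := by
          gcongr
      _ = ENNReal.ofReal ((2 * r) ^ 2 * 2 ^ n * (C * r ^ (n - 2))) * W := by
          have e2 : (2 : ℝ≥0∞) ^ n = ENNReal.ofReal (2 ^ n) := by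
            rw [ENNReal.ofReal_pow zero_le_two]; norm_num
          rw [e2, ← ENNReal.ofReal_pow (by positivity),
            ENNReal.ofReal_mul (p := (2 * r) ^ 2 * 2 ^ n) (by positivity),
            ENNReal.ofReal_mul (p := (2 * r) ^ 2) (by positivity)]
          ring
      _ = ENNReal.ofReal (4 * 2 ^ n * C / v) * W ^ 2 := by
          rw [sq W, ← mul_assoc (ENNReal.ofReal _) W W]
          congr 1
          rw [hW, volume_ball_eq x hr, ← ENNReal.ofReal_mul (by positivity)]
          congr 1
          have e : r ^ n = r ^ (n - 2) * r ^ 2 := by rw [← pow_add]; congr 1; omega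
          rw [e]
          field_simp
          ring
  have hum : AEMeasurable u (volume.restrict (ball x r)) :=
    (hu.1.memLp.1.mono_measure (Measure.restrict_mono hB le_rfl)).aemeasurable
  calc ∫⁻ y in ball x r, ∫⁻ z in ball x r, ‖Real.log (u y + δ) - Real.log (u z + δ)‖ₑ ^ 2
      ≤ ∫⁻ y in ball x r, ∫⁻ z in ball x r,
          (2 * ‖Real.arsinh (u y / δ) - Real.arsinh (u z / δ)‖ₑ ^ 2 + 2) := by
        refine lintegral_mono_ae ?_
        filter_upwards [hpos'] with y hy
        refine lintegral_mono_ae ?_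
        filter_upwards [hpos'] with z hz
        exact enorm_log_sub_sq_le hy hz hδ
    _ = 2 * (∫⁻ y in ball x r, ∫⁻ z in ball x r,
          ‖Real.arsinh (u y / δ) - Real.arsinh (u z / δ)‖ₑ ^ 2) + 2 * W ^ 2 := by
        simp_rw [lintegral_add_right _ measurable_const,
          lintegral_const_mul' _ _ (ENNReal.ofNat_ne_top (n := 2))]
        simp only [lintegral_const, Measure.restrict_apply_univ, ← hW, sq, mul_assoc]
    _ ≤ 2 * (ENNReal.ofReal (4 * 2 ^ n * C / v) * W ^ 2) + 2 * W ^ 2 := by gcongr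
    _ = _ := by
        rw [ENNReal.ofReal_add (by positivity) (by positivity), add_mul, ← mul_assoc]
        have e : (8 * 2 ^ n * C / v) = 2 * (4 * 2 ^ n * C / v) := by ring
        rw [e, ENNReal.ofReal_mul (by positivity)]
        norm_num

/-- Moving from `y` directly away from `x` reaches distances arbitrarily close to `dist y x + s`. If
`y = x` any unit vector serves, which requires `n > 0`. -/
theorem dist_add_le_of_ball_subset_ball {n : ℕ} (hn : 0 < n) {x y : Rn n} {s R : ℝ}
    (hs : 0 < s) (h : ball y s ⊆ ball x R) : dist y x + s ≤ R := by
  obtain ⟨e, he, hyx⟩ : ∃ e : Rn n, ‖e‖ = 1 ∧ y - x = dist y x • e := by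
    by_cases hxy : y = x
    · exact ⟨EuclideanSpace.single ⟨0, hn⟩ 1, by simp, by simp [hxy]⟩
    · have h0 : ‖y - x‖ ≠ 0 := norm_ne_zero_iff.2 (sub_ne_zero.2 hxy)
      refine ⟨‖y - x‖⁻¹ • (y - x), ?_, ?_⟩
      · rw [norm_smul, norm_inv, norm_norm, inv_mul_cancel₀ h0]
      · rw [dist_eq_norm, smul_smul, mul_inv_cancel₀ h0, one_smul]
  refine le_of_forall_lt fun t ht => ?_
  set τ := max (t - dist y x) 0 with hτ
  have hτs : τ < s := max_lt (by linarith) hs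
  have hτ0 : 0 ≤ τ := le_max_right _ _
  have h1 : y + τ • e ∈ ball x R := by
    apply h
    rw [mem_ball, dist_eq_norm, add_sub_cancel_left, norm_smul, he, mul_one,
      Real.norm_of_nonneg hτ0]
    exact hτs
  have h2 : y + τ • e - x = (dist y x + τ) • e := by
    rw [add_smul, ← hyx]; abel
  rw [mem_ball, dist_eq_norm, h2, norm_smul, he, mul_one,
    Real.norm_of_nonneg (by positivity)] at h1
  have := le_max_left (t - dist y x) 0
  linarith

/-- The oscillation bound for `log (u + δ)`, under the scale-invariant `L¹` bounds on the
potentials `bᵢ²` and `V`. -/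
theorem exists_log_oscillation_bound {n : ℕ} (hn : 2 ≤ n) {α lam M : ℝ} (hα : 0 < α)
    (hα2 : α ≤ 2) (hlam : 0 < lam) (hM : 0 ≤ M) : ∃ C : ℝ, 0 < C ∧
    ∀ (Ω : Set (Rn n)) (a : Fin n → Fin n → Rn n → ℝ) (b : Fin n → Rn n → ℝ) (V : Rn n → ℝ),
      IsOpen Ω → IsElliptic Ω lam a →
    (∀ i, MemLp (b i) 2 (volume.restrict Ω)) → Integrable V (volume.restrict Ω) →
    (∀ i (x : Rn n) (r : ℝ), 0 < r → r ≤ 1 →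
      ∫⁻ y in ball x (2 * r), ‖b i y‖ₑ ^ 2 ≤ ENNReal.ofReal (M * r ^ (n - 2))) →
    (∀ (x : Rn n) (r : ℝ), 0 < r → r ≤ 1 →
      ∫⁻ y in ball x (2 * r), ‖V y‖ₑ ≤ ENNReal.ofReal (M * r ^ (n - 2))) →
    ∀ u : Rn n → ℝ, IsWeakSolution Ω a b V u → (∀ᵐ y ∂(volume.restrict Ω), 0 ≤ u y) →
    ∀ (x : Rn n) (r : ℝ), 0 < r → r ≤ 1 → ball x (2 * r) ⊆ Ω →
    ∀ δ : ℝ, 0 < δ →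
      IntegrableOn (fun y => Real.log (u y + δ)) (ball x r) ∧
      meanOsc α (fun y => Real.log (u y + δ)) x r ≤ ENNReal.ofReal C ∧
      MemBMO α (fun y => Real.log (u y + δ)) x r := by
  obtain ⟨C, hC, hgrad⟩ := exists_lintegral_grad_le hn hlam hM
  set v := (volume (ball (0 : Rn n) 1)).toReal
  have hv : 0 < v := volume_unit_ball_pos n
  -- The `1` is from `|t|^α ≤ 1 + t²`; the `8` is `(2r)²` in Poincaré doubled by `(B + 1)² ≤ 2B² +
  -- 2`, whose additive term is the final `2`.
  set C' := 1 + (8 * 2 ^ n * C / v + 2)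
  have hC' : 0 < C' := by positivity
  refine ⟨C', hC', ?_⟩
  intro Ω a b V hΩ ha hb hV hbM hVM u ⟨Du, hu, hsol⟩ hpos
  have key : ∀ (x : Rn n) (r : ℝ), 0 < r → r ≤ 1 → ball x (2 * r) ⊆ Ω → ∀ δ : ℝ, 0 < δ →
      IntegrableOn (fun y => Real.log (u y + δ)) (ball x r) ∧
      meanOsc α (fun y => Real.log (u y + δ)) x r ≤ ENNReal.ofReal C' := by
    intro x r hr hr1 hB δ hδ
    have hB' : ball x r ⊆ Ω := (ball_subset_ball (by linarith)).trans hB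
    have hle : volume.restrict (ball x r) ≤ volume.restrict Ω := Measure.restrict_mono hB' le_rfl
    have hint := integrableOn_log_add (hu.1.memLp.mono_measure hle) (ae_mono hle hpos) hδ
    refine ⟨hint, ?_⟩
    have h1 := hgrad Ω a b V u Du hΩ ha hb hV hbM hVM hu hsol hpos x r hr hr1 hB δ hδ
    have h2 := lintegral_lintegral_log_sub_sq_le hn hu hpos hr hB' hδ hC h1
    refine (meanOsc_le_of_lintegral_lintegral hα.le hα2 hr hint h2).trans (le_of_eq ?_)
    rw [ENNReal.ofReal_add zero_le_one (by positivity), ENNReal.ofReal_one]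
  intro x r hr hr1 hB δ hδ
  obtain ⟨h1, h2⟩ := key x r hr hr1 hB δ hδ
  refine ⟨h1, h2, h1, C' ^ (1 / α), by positivity, fun y s hs hys => ?_⟩
  -- From `dist y x + s ≤ r` the doubled ball `B(y, 2s)` stays in `B(x, 2r) ⊆ Ω`, so the same
  -- estimate applies to every sub-ball with the same constant.
  have hd := dist_add_le_of_ball_subset_ball (by omega) hs hys
  have hd0 := dist_nonneg (x := y) (y := x)
  have hB2 : ball y (2 * s) ⊆ Ω := (ball_subset_ball' (by linarith)).trans hB
  rw [← ENNReal.ofReal_rpow_of_pos hC']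
  exact ENNReal.rpow_le_rpow (key y s hs (by linarith) hB2 δ hδ).2 (by positivity)

/-! ### Growth bounds for the potentials -/

theorem MemLpLoc.integrable_restrict {n : ℕ} {p : ℝ} (hp : 1 ≤ p) {f : Rn n → ℝ}
    (hf : MemLpLoc p f) {Ω : Set (Rn n)} (hΩ : Bornology.IsBounded Ω) :
    Integrable f (volume.restrict Ω) := by
  have hc := hΩ.isCompact_closure
  have : IsFiniteMeasure (volume.restrict (closure Ω)) :=
    ⟨by simpa using hc.measure_lt_top⟩
  have h1 : Integrable f (volume.restrict (closure Ω)) :=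
    (hf _ hc).integrable (by simpa using ENNReal.ofReal_le_ofReal hp)
  exact h1.mono_measure (Measure.restrict_mono subset_closure le_rfl)

theorem MemLpLoc.memLp_two_restrict {n : ℕ} {p : ℝ} (hp : 1 ≤ p) {f : Rn n → ℝ}
    (hm : AEMeasurable f volume) (hf : MemLpLoc p (fun y => f y ^ 2)) {Ω : Set (Rn n)}
    (hΩ : Bornology.IsBounded Ω) : MemLp f 2 (volume.restrict Ω) :=
  (memLp_two_iff_integrable_sq hm.aestronglyMeasurable.restrict).2 (hf.integrable_restrict hp hΩ)

theorem two_mul_rpow_sub_le {n : ℕ} (hn : 2 ≤ n) {α r : ℝ} (hα : 1 ≤ α) (hα2 : α ≤ 2)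
    (hr : 0 < r) (hr1 : r ≤ 1) : (2 * r) ^ ((n : ℝ) - α) ≤ 2 ^ n * r ^ (n - 2) := by
  rw [Real.mul_rpow zero_le_two hr.le]
  gcongr
  · rw [← Real.rpow_natCast]
    exact Real.rpow_le_rpow_of_exponent_le one_le_two (by linarith)
  · rw [← Real.rpow_natCast, Nat.cast_sub hn]
    exact Real.rpow_le_rpow_of_exponent_ge hr hr1 (by push_cast; linarith)

theorem lintegral_ball_le_of_stummelModulus_le {n : ℕ} {α K R : ℝ} (hαn : α < n)
    {V : Rn n → ℝ} (hV : stummelModulus α V R ≤ ENNReal.ofReal K) (x : Rn n) {ρ : ℝ}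
    (hρ : 0 < ρ) (hρR : ρ ≤ R) :
    ∫⁻ y in ball x ρ, ‖V y‖ₑ ≤ ENNReal.ofReal (|K| * ρ ^ ((n : ℝ) - α)) := by
  have hα : 0 ≤ (n : ℝ) - α := by linarith
  set D := ENNReal.ofReal (ρ ^ ((n : ℝ) - α))
  have hD : D ≠ 0 := by simpa [D] using Real.rpow_pos_of_pos hρ _
  calc ∫⁻ y in ball x ρ, ‖V y‖ₑ
      ≤ ∫⁻ y in ball x ρ, D * (‖V y‖ₑ / ‖x - y‖ₑ ^ ((n : ℝ) - α)) := by
        refine setLIntegral_mono' measurableSet_ball fun y hy => ?_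
        have h1 : ‖x - y‖ₑ ^ ((n : ℝ) - α) ≤ D := by
          simp only [D]
          rw [← ENNReal.ofReal_rpow_of_nonneg hρ.le hα]
          refine ENNReal.rpow_le_rpow ?_ hα
          rw [← ofReal_norm, ← dist_eq_norm, dist_comm]
          exact ENNReal.ofReal_le_ofReal (mem_ball.1 hy).le
        calc ‖V y‖ₑ = D * (‖V y‖ₑ / D) := (ENNReal.mul_div_cancel hD ENNReal.ofReal_ne_top).symm
          _ ≤ _ := by gcongr
    _ = D * ∫⁻ y in ball x ρ, ‖V y‖ₑ / ‖x - y‖ₑ ^ ((n : ℝ) - α) :=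
        lintegral_const_mul' _ _ ENNReal.ofReal_ne_top
    _ ≤ D * ENNReal.ofReal |K| := by
        gcongr
        refine (lintegral_mono_set (ball_subset_ball hρR)).trans ?_
        refine le_trans ?_ (hV.trans (ENNReal.ofReal_le_ofReal (le_abs_self K)))
        exact le_iSup (fun x : Rn n => ∫⁻ y in ball x R, ‖V y‖ₑ / ‖x - y‖ₑ ^ ((n : ℝ) - α)) x
    _ = _ := by rw [← ENNReal.ofReal_mul (by positivity), mul_comm]

/-- Restricting the integral to `(ρ, 2ρ]`, where `φ(t) ≥ φ(ρ) / C₁`, already bounds `φ(ρ) ρ^(1-e)`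
by a multiple of `ρ^((p/2)(1-α))`; the exponents combine to `n - pα`. -/
theorem exists_le_rpow_of_nakaiCondition {n : ℕ} {α p : ℝ} {φ : ℝ → ℝ} (hα : 1 ≤ α)
    (hp0 : 0 < p) (hp : p < n / α) (hφ : ∀ t : ℝ, 0 < t → 0 < φ t) (hinc : AlmostIncreasing φ)
    (hN : NakaiCondition n α p φ) :
    ∃ c : ℝ, 0 ≤ c ∧ ∀ ρ : ℝ, 0 < ρ → φ ρ ≤ c * ρ ^ ((n : ℝ) - p * α) := by
  obtain ⟨C₁, hC₁, hinc⟩ := hinc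
  obtain ⟨C₃, hC₃, hN⟩ := hN
  have hpα : p * α < n := (lt_div_iff₀ (by linarith)).1 hp
  set e := ((n : ℝ) + 1) - p / 2 * (α + 1) with he
  -- Since `α ≥ 1`, `(p/2)(α + 1) ≤ pα < n`.
  have he0 : 0 ≤ e := by nlinarith
  refine ⟨C₁ * C₃ * 2 ^ e, by positivity, fun ρ hρ => ?_⟩
  have hφρ := hφ ρ hρ
  have hlow : ENNReal.ofReal (φ ρ / C₁ / (2 * ρ) ^ e * ρ) ≤
      ENNReal.ofReal (C₃ * ρ ^ (p / 2 * (1 - α))) := by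
    refine le_trans ?_ (hN ρ hρ)
    calc ENNReal.ofReal (φ ρ / C₁ / (2 * ρ) ^ e * ρ)
        = ∫⁻ _ in Ioc ρ (2 * ρ), ENNReal.ofReal (φ ρ / C₁ / (2 * ρ) ^ e) := by
          rw [setLIntegral_const, Real.volume_Ioc, ← ENNReal.ofReal_mul (by positivity)]
          congr 2
          ring
      _ ≤ ∫⁻ t in Ioc ρ (2 * ρ), ENNReal.ofReal (φ t / t ^ e) := by
          refine setLIntegral_mono' measurableSet_Ioc fun t ht => ENNReal.ofReal_le_ofReal ?_
          have ht0 : 0 < t := hρ.trans ht.1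
          have h1 : φ ρ / C₁ ≤ φ t := by
            rw [div_le_iff₀ hC₁, mul_comm]
            exact hinc ρ t hρ ht.1.le
          have h2 : t ^ e ≤ (2 * ρ) ^ e := Real.rpow_le_rpow ht0.le ht.2 he0
          have := hφ t ht0
          gcongr
      _ ≤ _ := lintegral_mono_set Ioc_subset_Ioi_self
  rw [ENNReal.ofReal_le_ofReal_iff (by positivity), Real.mul_rpow zero_le_two hρ.le] at hlow
  have hexp : ρ ^ ((n : ℝ) - p * α) = ρ ^ e * ρ ^ (p / 2 * (1 - α)) / ρ := by
    rw [← Real.rpow_add hρ, ← Real.rpow_sub_one hρ.ne']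
    congr 1
    rw [he]; ring
  have h2e : (0 : ℝ) < 2 ^ e := by positivity
  have hρe : 0 < ρ ^ e := by positivity
  rw [hexp]
  calc φ ρ = (φ ρ / C₁ / (2 ^ e * ρ ^ e) * ρ) * (C₁ * (2 ^ e * ρ ^ e) / ρ) := by
        field_simp
    _ ≤ (C₃ * ρ ^ (p / 2 * (1 - α))) * (C₁ * (2 ^ e * ρ ^ e) / ρ) := by gcongr
    _ = _ := by ring

/-- Values below the level `τ` are bounded by `τ`, larger ones by `τ^(1-p) |t|^p`. This replaces
Hölder's inequality on balls. -/
theorem enorm_le_add_mul_rpow {p τ : ℝ} (hp : 1 ≤ p) (hτ : 0 < τ) (t : ℝ) :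
    ‖t‖ₑ ≤ ENNReal.ofReal τ + ENNReal.ofReal (τ ^ (1 - p)) * ‖t‖ₑ ^ p := by
  have h : |t| ≤ τ + τ ^ (1 - p) * |t| ^ p := by
    rcases le_total |t| τ with h1 | h1
    · have : 0 ≤ τ ^ (1 - p) * |t| ^ p := by positivity
      linarith
    · have ht : 0 < |t| := hτ.trans_le h1
      calc |t| = |t| ^ (1 - p) * |t| ^ p := by
            rw [← Real.rpow_add ht, sub_add_cancel, Real.rpow_one]
        _ ≤ τ ^ (1 - p) * |t| ^ p :=
            mul_le_mul_of_nonneg_right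
              (Real.rpow_le_rpow_of_nonpos hτ h1 (by linarith : 1 - p ≤ 0)) (by positivity)
        _ ≤ _ := le_add_of_nonneg_left hτ.le
  rw [Real.enorm_eq_ofReal_abs, ENNReal.ofReal_rpow_of_nonneg (abs_nonneg _) (by linarith),
    ← ENNReal.ofReal_mul (by positivity), ← ENNReal.ofReal_add hτ.le (by positivity)]
  exact ENNReal.ofReal_le_ofReal h

theorem lintegral_rpow_le_of_morreyNorm_le {n : ℕ} {p K : ℝ} {φ : ℝ → ℝ} (hp : 0 < p)
    (hφ : ∀ t : ℝ, 0 < t → 0 < φ t) {f : Rn n → ℝ}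
    (hf : morreyNorm p φ f ≤ ENNReal.ofReal K) (x : Rn n) {ρ : ℝ} (hρ : 0 < ρ) :
    ∫⁻ y in ball x ρ, ‖f y‖ₑ ^ p ≤ ENNReal.ofReal (|K| ^ p * φ ρ) := by
  have h1 : ((∫⁻ y in ball x ρ, ‖f y‖ₑ ^ p) / ENNReal.ofReal (φ ρ)) ^ (1 / p) ≤
      ENNReal.ofReal |K| := by
    refine le_trans ?_ (hf.trans (ENNReal.ofReal_le_ofReal (le_abs_self K)))
    unfold morreyNorm
    exact le_iSup_of_le x (le_iSup_of_le ρ (le_iSup_of_le hρ le_rfl))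
  rw [one_div, ENNReal.rpow_inv_le_iff hp, ENNReal.div_le_iff (by simpa using hφ ρ hρ)
    ENNReal.ofReal_ne_top, ENNReal.ofReal_rpow_of_nonneg (abs_nonneg _) hp.le,
    ← ENNReal.ofReal_mul (by positivity)] at h1
  exact h1

theorem lintegral_ball_le_of_morreyNorm_le {n : ℕ} {α p K c : ℝ} {φ : ℝ → ℝ}
    (hp : 1 ≤ p) (hφ : ∀ t : ℝ, 0 < t → 0 < φ t) (hc : 0 ≤ c)
    (hφc : ∀ ρ : ℝ, 0 < ρ → φ ρ ≤ c * ρ ^ ((n : ℝ) - p * α)) {f : Rn n → ℝ}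
    (hf : morreyNorm p φ f ≤ ENNReal.ofReal K) (x : Rn n) {ρ : ℝ} (hρ : 0 < ρ) :
    ∫⁻ y in ball x ρ, ‖f y‖ₑ ≤ ENNReal.ofReal
      (((volume (ball (0 : Rn n) 1)).toReal + |K| ^ p * c) * ρ ^ ((n : ℝ) - α)) := by
  have h1 := lintegral_rpow_le_of_morreyNorm_le (by linarith) hφ hf x hρ
  set v := (volume (ball (0 : Rn n) 1)).toReal
  have hv : 0 < v := volume_unit_ball_pos n
  -- This level balances the two terms: both `τ ρⁿ` and `τ^(1-p) ρ^(n-pα)` equal `ρ^(n-α)`.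
  set τ := ρ ^ (-α) with hτ
  have hτ0 : 0 < τ := by positivity
  calc ∫⁻ y in ball x ρ, ‖f y‖ₑ
      ≤ ∫⁻ y in ball x ρ, (ENNReal.ofReal τ + ENNReal.ofReal (τ ^ (1 - p)) * ‖f y‖ₑ ^ p) :=
        lintegral_mono fun y => enorm_le_add_mul_rpow hp hτ0 (f y)
    _ = ENNReal.ofReal τ * volume (ball x ρ) +
          ENNReal.ofReal (τ ^ (1 - p)) * ∫⁻ y in ball x ρ, ‖f y‖ₑ ^ p := by
        rw [lintegral_add_left measurable_const, setLIntegral_const,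
          lintegral_const_mul' _ _ ENNReal.ofReal_ne_top]
    _ ≤ ENNReal.ofReal τ * ENNReal.ofReal (ρ ^ n * v) + ENNReal.ofReal (τ ^ (1 - p)) *
          ENNReal.ofReal (|K| ^ p * (c * ρ ^ ((n : ℝ) - p * α))) := by
        rw [volume_ball_eq x hρ]
        gcongr
        refine h1.trans (ENNReal.ofReal_le_ofReal ?_)
        gcongr
        exact hφc ρ hρ
    _ = _ := by
        rw [← ENNReal.ofReal_mul (by positivity), ← ENNReal.ofReal_mul (by positivity),
          ← ENNReal.ofReal_add (by positivity) (by positivity)]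
        congr 1
        have e1 : τ * ρ ^ n = ρ ^ ((n : ℝ) - α) := by
          rw [hτ, ← Real.rpow_natCast, ← Real.rpow_add hρ]
          congr 1; ring
        have e2 : τ ^ (1 - p) * ρ ^ ((n : ℝ) - p * α) = ρ ^ ((n : ℝ) - α) := by
          rw [hτ, ← Real.rpow_mul hρ.le, ← Real.rpow_add hρ]
          congr 1; ring
        calc τ * (ρ ^ n * v) + τ ^ (1 - p) * (|K| ^ p * (c * ρ ^ ((n : ℝ) - p * α)))
            = (τ * ρ ^ n) * v + (τ ^ (1 - p) * ρ ^ ((n : ℝ) - p * α)) * (|K| ^ p * c) := by ring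
          _ = _ := by rw [e1, e2]; ring

/-! ### Assembly of the Morrey and Stummel cases -/

theorem theorem1p3 (n : ℕ) (α lam : ℝ) (hαn : α < n) (hα2 : α ≤ 2) (hlam : 0 < lam) (K : ℝ) :
    -- potentials in generalized Morrey spaces
    (1 < α →
      ∀ (p : ℝ) (φ : ℝ → ℝ), 1 < p → p < n / α → (∀ t : ℝ, 0 < t → 0 < φ t) →
        AlmostIncreasing φ → AlmostDecreasingDiv n φ → NakaiCondition n α p φ →
      ∃ C : ℝ, 0 < C ∧
        ∀ (Ω : Set (Rn n)) (a : Fin n → Fin n → Rn n → ℝ) (b : Fin n → Rn n → ℝ) (V : Rn n → ℝ),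
          IsOpen Ω → Bornology.IsBounded Ω → IsElliptic Ω lam a →
          (∀ i, AEMeasurable (b i) volume) →
          (∀ i, MemMorrey p φ (fun y => b i y ^ 2)) → MemMorrey p φ V → MemLpLoc 2 V →
          (∀ i, morreyNorm p φ (fun y => b i y ^ 2) ≤ ENNReal.ofReal K) →
          morreyNorm p φ V ≤ ENNReal.ofReal K →
        ∀ u : Rn n → ℝ, IsWeakSolution Ω a b V u → (∀ᵐ y ∂(volume.restrict Ω), 0 ≤ u y) →
        ∀ (x : Rn n) (r : ℝ), 0 < r → r ≤ 1 → ball x (2 * r) ⊆ Ω →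
        ∀ δ : ℝ, 0 < δ →
          IntegrableOn (fun y => Real.log (u y + δ)) (ball x r) ∧
          meanOsc α (fun y => Real.log (u y + δ)) x r ≤ ENNReal.ofReal C ∧
          MemBMO α (fun y => Real.log (u y + δ)) x r) ∧
    -- potentials in bounded Stummel modulus classes
    (1 ≤ α →
      ∃ C : ℝ, 0 < C ∧
        ∀ (Ω : Set (Rn n)) (a : Fin n → Fin n → Rn n → ℝ) (b : Fin n → Rn n → ℝ) (V : Rn n → ℝ),
          IsOpen Ω → Bornology.IsBounded Ω → IsElliptic Ω lam a →
          (∀ i, AEMeasurable (b i) volume) →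
          (∀ i, MemStummel α (fun y => b i y ^ 2)) → MemStummel α V →
          (∀ i, stummelModulus α (fun y => b i y ^ 2) 2 ≤ ENNReal.ofReal K) →
          stummelModulus α V 2 ≤ ENNReal.ofReal K →
        ∀ u : Rn n → ℝ, IsWeakSolution Ω a b V u → (∀ᵐ y ∂(volume.restrict Ω), 0 ≤ u y) →
        ∀ (x : Rn n) (r : ℝ), 0 < r → r ≤ 1 → ball x (2 * r) ⊆ Ω →
        ∀ δ : ℝ, 0 < δ →
          IntegrableOn (fun y => Real.log (u y + δ)) (ball x r) ∧
          meanOsc α (fun y => Real.log (u y + δ)) x r ≤ ENNReal.ofReal C ∧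
          MemBMO α (fun y => Real.log (u y + δ)) x r) := by
  -- `1 ≤ α < n` forces `n ≥ 2`, so the natural-number exponent `n - 2` is not truncated.
  have hn : 1 ≤ α → 2 ≤ n := fun hα => by
    have : (1 : ℝ) < n := by linarith
    exact_mod_cast this
  have hsq : ∀ (f : Rn n → ℝ) (s : Set (Rn n)),
      ∫⁻ y in s, ‖f y‖ₑ ^ 2 = ∫⁻ y in s, ‖f y ^ 2‖ₑ := fun f s => by simp_rw [enorm_pow]
  have hscale : 1 ≤ α → ∀ A : ℝ, 0 ≤ A → ∀ r : ℝ, 0 < r → r ≤ 1 →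
      ENNReal.ofReal (A * (2 * r) ^ ((n : ℝ) - α)) ≤
        ENNReal.ofReal (A * 2 ^ n * r ^ (n - 2)) := fun hα A hA r hr hr1 => by
    rw [mul_assoc]
    exact ENNReal.ofReal_le_ofReal (mul_le_mul_of_nonneg_left
      (two_mul_rpow_sub_le (hn hα) hα hα2 hr hr1) hA)
  constructor
  · intro hα p φ hp1 hp hφ hinc _ hN
    obtain ⟨c, hc, hφc⟩ := exists_le_rpow_of_nakaiCondition hα.le (by linarith) hp hφ hinc hN
    set A := (volume (ball (0 : Rn n) 1)).toReal + |K| ^ p * c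
    have hA : 0 ≤ A := by positivity
    obtain ⟨C, hC, h⟩ := exists_log_oscillation_bound (hn hα.le) (by linarith : 0 < α) hα2 hlam
      (by positivity : 0 ≤ A * 2 ^ n)
    refine ⟨C, hC, fun Ω a b V hΩ hΩb ha hbm hb hV _ hbK hVK => h Ω a b V hΩ ha
      (fun i => (hb i).1.memLp_two_restrict hp1.le (hbm i) hΩb)
      (hV.1.integrable_restrict hp1.le hΩb) (fun i x r hr hr1 => ?_) (fun x r hr hr1 => ?_)⟩
    · rw [hsq]
      exact (lintegral_ball_le_of_morreyNorm_le hp1.le hφ hc hφc (hbK i) x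
        (by positivity)).trans (hscale hα.le A hA r hr hr1)
    · exact (lintegral_ball_le_of_morreyNorm_le hp1.le hφ hc hφc hVK x
        (by positivity)).trans (hscale hα.le A hA r hr hr1)
  · intro hα
    obtain ⟨C, hC, h⟩ := exists_log_oscillation_bound (hn hα) (by linarith : 0 < α) hα2 hlam
      (by positivity : 0 ≤ |K| * 2 ^ n)
    refine ⟨C, hC, fun Ω a b V hΩ hΩb ha hbm hb hV hbK hVK => h Ω a b V hΩ ha
      (fun i => (hb i).1.memLp_two_restrict le_rfl (hbm i) hΩb)
      (hV.1.integrable_restrict le_rfl hΩb) (fun i x r hr hr1 => ?_) (fun x r hr hr1 => ?_)⟩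
    · rw [hsq]
      exact (lintegral_ball_le_of_stummelModulus_le hαn (hbK i) x (by positivity)
        (by linarith)).trans (hscale hα _ (abs_nonneg K) r hr hr1)
    · exact (lintegral_ball_le_of_stummelModulus_le hαn hVK x (by positivity)
        (by linarith)).trans (hscale hα _ (abs_nonneg K) r hr hr1)
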